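/- Let $N\ge 2$ be an integer, let $V_N$ be the volume of the unit ball of $\mathbb R^N$, and put $$\mu_N(x)=\frac{1}{V_N\bigl(1+|x|^{\frac N{N-1}}\bigr)^N},\qquad d\mu_N=\mu_N(x)\,dx,\qquad v_N=\ln\mu_N .$$ Let $W_{\mu_N}(\mathbb R^N)$ be the set of all weakly differentiable real functions $u\in L^1(\mathbb R^N,d\mu_N)$ (that is, $u\in L^1_{loc}$ with distributional gradient $\nabla u\in L^1_{loc}$) such that $|\nabla u|\in L^N(\mathbb R^N,dx)$ and $|\nabla u|^2|\nabla v_N|^{N-2}\in L^1(\mathbb R^N,dx)$, with the norm $$\|u\|_{\mu_N}=\int_{\mathbb R^N}|u|\,d\mu_N+\|\nabla u\|_{L^N(\mathbb R^N)}+\Bigl(\int_{\mathbb R^N}|\nabla u|^2|\nabla v_N|^{N-2}\,dx\Bigr)^{1/2}.$$ Then $$W_{\mu_N}(\mathbb R^N)=\overline{C_0^\infty(\mathbb R^N)}^{\|\cdot\|_{\mu_N}}.$$ That is, a weakly differentiable function $u$ belongs to $W_{\mu_N}(\mathbb R^N)$ if and only if there are $\varphi_n\in C_0^\infty(\mathbb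 R^N)$ with $\|u-\varphi_n\|_{\mu_N}\to0$; and every sequence in $C_0^\infty(\mathbb R^N)$ that is Cauchy for $\|\cdot\|_{\mu_N}$ converges in this norm to an element of $W_{\mu_N}(\mathbb R^N)$, so that the closure is also the completion of $C_0^\infty(\mathbb R^N)$. -/

import Mathlib

open MeasureTheory Filter Topology
open scoped ContDiff ENNReal Gradient

namespace Onofri

noncomputable section

/-- `ℝ^N` with the Euclidean norm and Lebesgue measure. -/
abbrev Rn (N : ℕ) : Type := EuclideanSpace ℝ (Fin N)

/-- `V_N`, the volume of the unit ball of `ℝ^N`. -/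
def unitBallVolume (N : ℕ) : ℝ := (volume : Measure (Rn N)).real (Metric.ball 0 1)

/-- The density `μ_N(x) = 1 / (V_N (1 + |x|^{N/(N-1)})^N)`. -/
def muDensity (N : ℕ) (x : Rn N) : ℝ :=
  1 / (unitBallVolume N * (1 + ‖x‖ ^ ((N : ℝ) / ((N : ℝ) - 1))) ^ N)

/-- The measure `dμ_N = μ_N(x) dx`. -/
def mu (N : ℕ) : Measure (Rn N) :=
  (volume : Measure (Rn N)).withDensity (fun x => ENNReal.ofReal (muDensity N x))

/-- `v_N = ln μ_N`. -/
def v (N : ℕ) (x : Rn N) : ℝ := Real.log (muDensity N x)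

/-- `C_0^∞(ℝ^N)`: real-valued smooth functions with compact support. -/
def testFunctions (N : ℕ) : Set (Rn N → ℝ) :=
  {φ | ContDiff ℝ ∞ φ ∧ HasCompactSupport φ}

/-- `g` is a weak (distributional) gradient of `u`: both are locally integrable and
`∫ u ∇φ = - ∫ φ g` (an identity between vectors of `ℝ^N`) for every test function `φ`. -/
structure HasWeakGradient {N : ℕ} (u : Rn N → ℝ) (g : Rn N → Rn N) : Prop where
  locallyIntegrable : LocallyIntegrable u volume
  locallyIntegrable_grad : LocallyIntegrable g volume
  integral_eq : ∀ φ ∈ testFunctions N, ∫ x, u x • ∇ φ x = - ∫ x, φ x • g x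

/-- `u` is weakly differentiable: it is locally integrable and has a (locally integrable)
weak gradient. -/
def WeaklyDifferentiable {N : ℕ} (u : Rn N → ℝ) : Prop :=
  ∃ g : Rn N → Rn N, HasWeakGradient u g

/-- Weak gradients are unique up to null sets. -/
theorem HasWeakGradient.ae_unique {N : ℕ} {u : Rn N → ℝ} {g h : Rn N → Rn N}
    (hg : HasWeakGradient u g) (hh : HasWeakGradient u h) : g =ᵐ[volume] h := by
  refine ae_eq_of_integral_contDiff_smul_eq hg.locallyIntegrable_grad
    hh.locallyIntegrable_grad ?_
  intro φ hφ hc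
  have h1 := hg.integral_eq φ ⟨hφ, hc⟩
  have h2 := hh.integral_eq φ ⟨hφ, hc⟩
  exact neg_injective (h1.symm.trans h2)

open Classical in
/-- A representative of the weak gradient `∇u` of a weakly differentiable function `u`
(by `HasWeakGradient.ae_unique` the choice does not matter); it is only used for
weakly differentiable functions. -/
def weakGrad {N : ℕ} (u : Rn N → ℝ) : Rn N → Rn N :=
  if h : WeaklyDifferentiable u then h.choose else 0

theorem WeaklyDifferentiable.hasWeakGradient {N : ℕ} {u : Rn N → ℝ}
    (h : WeaklyDifferentiable u) : HasWeakGradient u (weakGrad u) := by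
  unfold weakGrad
  rw [dif_pos h]
  exact h.choose_spec

/-- The weighted Sobolev space `W_{μ_N}(ℝ^N)`, as a set of functions. -/
def W (N : ℕ) : Set (Rn N → ℝ) :=
  {u | WeaklyDifferentiable u ∧
    Integrable u (mu N) ∧
    MemLp (weakGrad u) (N : ℝ≥0∞) volume ∧
    Integrable (fun x => ‖weakGrad u x‖ ^ 2 * ‖∇ (v N) x‖ ^ (N - 2)) volume}

/-- The norm
`‖u‖_{μ_N} = ∫ |u| dμ_N + ‖∇u‖_N + (∫ |∇u|² |∇v_N|^{N-2} dx)^{1/2}`, with values in `[0, ∞]`,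
for weakly differentiable `u`. -/
def muNorm (N : ℕ) (u : Rn N → ℝ) : ℝ≥0∞ :=
  (∫⁻ x, ‖u x‖ₑ ∂(mu N)) + eLpNorm (weakGrad u) (N : ℝ≥0∞) volume +
    (∫⁻ x, ‖weakGrad u x‖ₑ ^ 2 * ‖∇ (v N) x‖ₑ ^ (N - 2)) ^ (1 / 2 : ℝ)

/-- The closure of `C_0^∞(ℝ^N)` for `‖·‖_{μ_N}`: all weakly differentiable functions that are
limits, in this norm, of a sequence of test functions. -/
def testClosure (N : ℕ) : Set (Rn N → ℝ) :=
  {u | WeaklyDifferentiable u ∧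
    ∃ φ : ℕ → Rn N → ℝ, (∀ n, φ n ∈ testFunctions N) ∧
      Tendsto (fun n => muNorm N (u - φ n)) atTop (𝓝 0)}

/-- `φ` is a Cauchy sequence for `‖·‖_{μ_N}`. -/
def IsMuCauchy (N : ℕ) (φ : ℕ → Rn N → ℝ) : Prop :=
  ∀ ε : ℝ≥0∞, 0 < ε → ∃ n₀, ∀ m ≥ n₀, ∀ n ≥ n₀, muNorm N (φ m - φ n) < ε

end

end Onofri

/-! The closure lies in `W` by the triangle inequality: test functions have finite norm because
`∇v_N` is bounded. The converse is a density statement, proved by three reductions: truncate to a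
bounded function, cut off to a compactly supported one, mollify.

The decisive reduction is the cutoff (`tendsto_lintegral_gradient_cutoff`). Since `|∇v_N| ≤ D/|x|`,
both gradient seminorms have the same critical scaling at infinity. For a logarithmic cutoff `η_n`,
`|∇η_n| ≤ C/((n+1)|x|)` on `1 ≤ |x| ≤ e^{n+1}` and zero elsewhere. Hence for `k = N` and `k = 2` the
integral of `|∇η_n|^k |∇v_N|^{N-k}` is at most a constant times `(n+1)^{-2} ∫ |x|^{-N} dx`, which is
of order `1/(n+1)`. So `u ∇η_n` tends to zero as soon as `u` is bounded, with no Hardy or Poincaré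
inequality (`approximable_of_bounded`). Boundedness is obtained from `c sin(u/c)`, a smooth
truncation with weak gradient `cos(u/c) ∇u`, handled by dominated convergence (`approximable`).

For completeness, a Cauchy sequence converges in `L^1(μ_N)`, its gradients in `L^N(dx)`. Both
convergences hold in `L^1` on compact sets, so the second limit is the weak gradient of the first.
Convergence in the remaining seminorm follows from Fatou's lemma.

Estimates are made for pairs (function, weak gradient) through `pairNorm`, which removes the chosen
representative `weakGrad`. -/

namespace Onofri

open scoped Convolution
open ContinuousLinearMap (lsmul)

/-! ### Convergence of mollifications in `L^p` and in `L^1` on compact sets. -/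

section Mollification

variable {G F : Type*} [NormedAddCommGroup G] [NormedSpace ℝ G] [FiniteDimensional ℝ G]
  [MeasurableSpace G] [BorelSpace G] [NormedAddCommGroup F]

/-- Translations are continuous in `L^p`. -/
theorem tendsto_eLpNorm_translate_sub (μ : Measure G) [μ.IsAddHaarMeasure] {p : ℝ≥0∞}
    (hp1 : 1 ≤ p) (hp : p ≠ ⊤) {f : G → F} (hf : MemLp f p μ) :
    Tendsto (fun t => eLpNorm (fun x => f (x - t) - f x) p μ) (𝓝 0) (𝓝 0) := by
  have : Fact (1 ≤ p) := ⟨hp1⟩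
  -- Currying a jointly continuous map makes `t ↦ (x ↦ x - t)` continuous into the space of
  -- continuous maps, as `Continuous.compMeasurePreservingLp` requires.
  let T : C(G × G, G) := ⟨fun q => q.2 - q.1, by fun_prop⟩
  have hmp : ∀ t, MeasurePreserving (T.curry t) μ μ := fun t => measurePreserving_sub_right μ t
  have hc := Continuous.compMeasurePreservingLp (p := p) (μ := μ) (ν := μ)
    (f := fun _ : G => hf.toLp f) continuous_const T.curry.continuous hmp hp
  have h0 := (hc.tendsto 0).sub (tendsto_const_nhds (x := hf.toLp f))
  have hz : Lp.compMeasurePreserving (T.curry 0) (hmp 0) (hf.toLp f) = hf.toLp f := by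
    rw [Lp.toLp_compMeasurePreserving]
    congr 1
    ext x
    simp [T]
  rw [hz, sub_self] at h0
  have h1 := (tendsto_iff_edist_tendsto_0.1 h0)
  refine h1.congr fun t => ?_
  rw [edist_zero_right, Lp.toLp_compMeasurePreserving, ← MemLp.toLp_sub, Lp.enorm_toLp]
  rfl

variable [NormedSpace ℝ F]

/-- Jensen's inequality for convolution with a probability density: if translations by
`t ∈ supp ρ` move `f` by at most `ε` in `L^p`, so does convolution with `ρ`. -/
theorem eLpNorm_convolution_sub_le (μ : Measure G) [μ.IsAddHaarMeasure] {p : ℝ≥0∞}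
    (hp1 : 1 ≤ p) (hp : p ≠ ⊤) {f : G → F} (hf : LocallyIntegrable f μ) [CompleteSpace F]
    (ρ : ContDiffBump (0 : G)) {ε : ℝ≥0∞}
    (hε : ∀ t, ‖t‖ < ρ.rOut → eLpNorm (fun x => f (x - t) - f x) p μ ≤ ε) :
    eLpNorm (fun x => (ρ.normed μ ⋆[lsmul ℝ ℝ, μ] f) x - f x) p μ ≤ ε := by
  have hp0 : p ≠ 0 := (zero_lt_one.trans_le hp1).ne'
  have hpr : 0 < p.toReal := ENNReal.toReal_pos hp0 hp
  have hfm : AEStronglyMeasurable f μ := hf.aestronglyMeasurable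
  set w : G → ℝ≥0∞ := fun t => ENNReal.ofReal (ρ.normed μ t) with hw
  have hwm : Measurable w := ρ.continuous_normed.measurable.ennreal_ofReal
  set ν : Measure G := μ.withDensity w with hν
  have hw1 : ∫⁻ t, w t ∂μ = 1 := by
    rw [hw, ← ofReal_integral_eq_lintegral_ofReal ρ.integrable_normed
      (Eventually.of_forall ρ.nonneg_normed), ρ.integral_normed, ENNReal.ofReal_one]
  have : IsProbabilityMeasure ν := ⟨by
    rw [hν, withDensity_apply _ MeasurableSet.univ, Measure.restrict_univ, hw1]⟩
  have hac : ν ≪ μ := withDensity_absolutelyContinuous _ _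
  have hshift : ∀ x, AEStronglyMeasurable (fun t => f (x - t) - f x) μ := fun x =>
    (hfm.comp_measurePreserving (Measure.measurePreserving_sub_left μ x)).sub
      aestronglyMeasurable_const
  have hpt : ∀ x, ‖(ρ.normed μ ⋆[lsmul ℝ ℝ, μ] f) x - f x‖ₑ ^ p.toReal ≤
      ∫⁻ t, w t * ‖f (x - t) - f x‖ₑ ^ p.toReal ∂μ := by
    intro x
    have hint : Integrable (fun t => ρ.normed μ t • f (x - t)) μ :=
      (ρ.hasCompactSupport_normed.convolutionExists_left (lsmul ℝ ℝ) ρ.continuous_normed hf x)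
    have e1 : (ρ.normed μ ⋆[lsmul ℝ ℝ, μ] f) x - f x =
        ∫ t, ρ.normed μ t • (f (x - t) - f x) ∂μ := by
      simp_rw [smul_sub]
      rw [integral_sub hint (ρ.integrable_normed.smul_const _), ρ.integral_normed_smul μ]
      rfl
    have e2 : ‖(ρ.normed μ ⋆[lsmul ℝ ℝ, μ] f) x - f x‖ₑ ≤
        eLpNorm (fun t => f (x - t) - f x) 1 ν := by
      rw [e1, eLpNorm_one_eq_lintegral_enorm, hν,
        lintegral_withDensity_eq_lintegral_mul₀ hwm.aemeasurable (hshift x).enorm]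
      refine (enorm_integral_le_lintegral_enorm _).trans (lintegral_mono fun t => ?_)
      rw [enorm_smul, Pi.mul_apply, Real.enorm_of_nonneg (ρ.nonneg_normed t)]
    -- Here Jensen's inequality enters: `ν = ρ dμ` is a probability measure, so its `L^1` norm is at
    -- most its `L^p` norm.
    have e3 := e2.trans (eLpNorm_le_eLpNorm_of_exponent_le hp1 ((hshift x).mono_ac hac))
    rw [eLpNorm_eq_lintegral_rpow_enorm_toReal hp0 hp] at e3
    refine (ENNReal.rpow_le_rpow e3 hpr.le).trans ?_
    rw [← ENNReal.rpow_mul, one_div_mul_cancel hpr.ne', ENNReal.rpow_one, hν,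
      lintegral_withDensity_eq_lintegral_mul₀ hwm.aemeasurable ((hshift x).enorm.pow_const _)]
    rfl
  have hprod : AEMeasurable (Function.uncurry fun x t => w t * ‖f (x - t) - f x‖ₑ ^ p.toReal)
      (μ.prod μ) := by
    refine (hwm.comp measurable_snd).aemeasurable.mul (AEMeasurable.pow_const ?_ _)
    exact ((hfm.comp_quasiMeasurePreserving
      (quasiMeasurePreserving_sub_of_right_invariant μ μ)).sub hfm.comp_fst).enorm
  rw [eLpNorm_eq_lintegral_rpow_enorm_toReal hp0 hp]
  have key : ∫⁻ x, ‖(ρ.normed μ ⋆[lsmul ℝ ℝ, μ] f) x - f x‖ₑ ^ p.toReal ∂μ ≤ ε ^ p.toReal := by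
    calc _ ≤ ∫⁻ x, ∫⁻ t, w t * ‖f (x - t) - f x‖ₑ ^ p.toReal ∂μ ∂μ := lintegral_mono hpt
      _ = ∫⁻ t, ∫⁻ x, w t * ‖f (x - t) - f x‖ₑ ^ p.toReal ∂μ ∂μ := lintegral_lintegral_swap hprod
      _ ≤ ∫⁻ t, w t * ε ^ p.toReal ∂μ := by
        refine lintegral_mono fun t => ?_
        dsimp only
        rw [lintegral_const_mul' _ _ ENNReal.ofReal_ne_top]
        by_cases ht : ‖t‖ < ρ.rOut
        · gcongr
          have := hε t ht
          rw [eLpNorm_eq_lintegral_rpow_enorm_toReal hp0 hp, one_div,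
            ENNReal.rpow_inv_le_iff hpr] at this
          exact this
        · have : t ∉ Function.support (ρ.normed μ) := by
            rw [ρ.support_normed_eq]; simpa using ht
          rw [Function.notMem_support] at this
          simp [hw, this]
      _ = ε ^ p.toReal := by rw [lintegral_mul_const _ hwm, hw1, one_mul]
  rwa [one_div, ENNReal.rpow_inv_le_iff hpr]

/-- Mollifications converge in `L^p`. -/
theorem tendsto_eLpNorm_convolution_sub (μ : Measure G) [μ.IsAddHaarMeasure] [CompleteSpace F]
    {p : ℝ≥0∞} (hp1 : 1 ≤ p) (hp : p ≠ ⊤) {f : G → F} (hf : MemLp f p μ)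
    {ρ : ℕ → ContDiffBump (0 : G)} (hρ : Tendsto (fun n => (ρ n).rOut) atTop (𝓝 0)) :
    Tendsto (fun n => eLpNorm (fun x => ((ρ n).normed μ ⋆[lsmul ℝ ℝ, μ] f) x - f x) p μ)
      atTop (𝓝 0) := by
  rw [ENNReal.tendsto_nhds_zero]
  intro ε hε
  have h1 := (ENNReal.tendsto_nhds_zero.1 (tendsto_eLpNorm_translate_sub μ hp1 hp hf)) ε hε
  obtain ⟨δ, hδ, hball⟩ := Metric.eventually_nhds_iff.1 h1
  filter_upwards [hρ.eventually (gt_mem_nhds hδ)] with n hn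
  refine eLpNorm_convolution_sub_le μ hp1 hp (hf.locallyIntegrable hp1) (ρ n) fun t ht => ?_
  exact hball (by rw [dist_zero_right]; exact ht.trans hn)

/-- Mollifications of a locally integrable function converge in `L^1` on compact sets. -/
theorem tendsto_eLpNorm_restrict_convolution_sub (μ : Measure G) [μ.IsAddHaarMeasure]
    [CompleteSpace F] {f : G → F} (hf : LocallyIntegrable f μ)
    {ρ : ℕ → ContDiffBump (0 : G)} (hρ : Tendsto (fun n => (ρ n).rOut) atTop (𝓝 0))
    {K : Set G} (hK : IsCompact K) :
    Tendsto (fun n => eLpNorm (((ρ n).normed μ ⋆[lsmul ℝ ℝ, μ] f) - f) 1 (μ.restrict K))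
      atTop (𝓝 0) := by
  -- A mollification of radius less than `1` evaluated on `K` only sees `f` on `K'`, so `f` may be
  -- replaced by an integrable function.
  set K' := Metric.cthickening 1 K
  have hK' : IsCompact K' := hK.cthickening
  set h := K'.indicator f with hh
  have hm : MemLp h 1 μ := by
    rw [memLp_one_iff_integrable, hh, integrable_indicator_iff hK'.measurableSet]
    exact hf.integrableOn_isCompact hK'
  refine tendsto_of_tendsto_of_tendsto_of_le_of_le' tendsto_const_nhds
    (tendsto_eLpNorm_convolution_sub μ le_rfl ENNReal.one_ne_top hm hρ)
    (Eventually.of_forall fun _ => zero_le) ?_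
  filter_upwards [hρ.eventually (gt_mem_nhds one_pos)] with n hn
  refine le_trans (le_of_eq ?_) (eLpNorm_mono_measure _ (Measure.restrict_le_self (s := K)))
  refine eLpNorm_congr_ae ((ae_restrict_iff' hK.measurableSet).2 (Eventually.of_forall ?_))
  intro x hx
  have hxh : h x = f x := Set.indicator_of_mem (Metric.self_subset_cthickening K hx) f
  simp only [Pi.sub_apply, hxh]
  congr 1
  refine integral_congr_ae (Eventually.of_forall fun t => ?_)
  by_cases ht : ‖t‖ < (ρ n).rOut
  · have : x - t ∈ K' := Metric.mem_cthickening_of_dist_le _ x _ _ hx (by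
      rw [dist_eq_norm]; simpa using (ht.trans hn).le)
    simp [hh, Set.indicator_of_mem this]
  · have : t ∉ Function.support ((ρ n).normed μ) := by
      rw [(ρ n).support_normed_eq]; simpa using ht
    rw [Function.notMem_support] at this
    simp [this]

end Mollification

variable {N : ℕ}

/-! ### Calculus of classical gradients. -/

section Gradient

theorem gradient_mul {a b : Rn N → ℝ} {x : Rn N} (ha : DifferentiableAt ℝ a x)
    (hb : DifferentiableAt ℝ b x) :
    ∇ (fun y => a y * b y) x = a x • ∇ b x + b x • ∇ a x := by
  simp only [gradient, fderiv_fun_mul ha hb, map_add, map_smul]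

theorem gradient_comp {f : ℝ → ℝ} {u : Rn N → ℝ} {x : Rn N} {f' : ℝ}
    (hf : HasDerivAt f f' (u x)) (hu : DifferentiableAt ℝ u x) :
    ∇ (fun y => f (u y)) x = f' • ∇ u x := by
  have := (hf.comp_hasFDerivAt x hu.hasFDerivAt).fderiv
  simp only [Function.comp_def] at this
  simp only [gradient, this, map_smul]

theorem continuous_gradient {a : Rn N → ℝ} (ha : ContDiff ℝ 1 a) : Continuous (∇ a) :=
  (InnerProductSpace.toDual ℝ (Rn N)).symm.continuous.comp (ha.continuous_fderiv one_ne_zero)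

theorem hasCompactSupport_gradient {a : Rn N → ℝ} (ha : HasCompactSupport a) :
    HasCompactSupport (∇ a) :=
  (ha.fderiv ℝ).comp_left (g := (InnerProductSpace.toDual ℝ (Rn N)).symm) (map_zero _)

theorem norm_gradient (a : Rn N → ℝ) (x : Rn N) : ‖∇ a x‖ = ‖fderiv ℝ a x‖ := by
  simp [gradient]

end Gradient

/-! ### Products and pairings with locally integrable functions. -/

section LocallyIntegrable

variable {F : Type*} [NormedAddCommGroup F] [NormedSpace ℝ F]

theorem LocallyIntegrable.smul_left_continuous {f : Rn N → F} (hf : LocallyIntegrable f volume)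
    {η : Rn N → ℝ} (hη : Continuous η) : LocallyIntegrable (fun x => η x • f x) volume :=
  locallyIntegrable_iff.2 fun _ hK =>
    (hf.integrableOn_isCompact hK).continuousOn_smul hη.continuousOn hK

theorem LocallyIntegrable.smul_right_continuous {u : Rn N → ℝ} (hu : LocallyIntegrable u volume)
    {h : Rn N → F} (hh : Continuous h) : LocallyIntegrable (fun x => u x • h x) volume :=
  locallyIntegrable_iff.2 fun _ hK =>
    (hu.integrableOn_isCompact hK).smul_continuousOn hh.continuousOn hK

/-- Pairing with a bounded function vanishing outside `K` is continuous for `L^1(K)`. -/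
theorem tendsto_integral_of_eLpNorm_restrict {F' : Type*} [NormedAddCommGroup F']
    [NormedSpace ℝ F'] {f : Rn N → F} {fn : ℕ → Rn N → F} {K : Set (Rn N)} (hK : MeasurableSet K)
    (h : Tendsto (fun n => eLpNorm (fn n - f) 1 (volume.restrict K)) atTop (𝓝 0))
    (T : Rn N → F →L[ℝ] F') {C : ℝ} (hC : ∀ x, ‖T x‖ ≤ C) (hTK : ∀ x, x ∉ K → T x = 0)
    (hi : ∀ n, Integrable (fun x => T x (fn n x)) volume)
    (hi' : Integrable (fun x => T x (f x)) volume) :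
    Tendsto (fun n => ∫ x, T x (fn n x)) atTop (𝓝 (∫ x, T x (f x))) := by
  refine tendsto_integral_of_L1 _ hi'.aestronglyMeasurable (Eventually.of_forall hi) ?_
  have h2 : Tendsto (fun n => ENNReal.ofReal C * eLpNorm (fn n - f) 1 (volume.restrict K)) atTop
      (𝓝 0) := by
    simpa using ENNReal.Tendsto.const_mul h (Or.inr ENNReal.ofReal_ne_top)
  refine tendsto_of_tendsto_of_tendsto_of_le_of_le tendsto_const_nhds h2 (fun _ => zero_le)
    fun n => ?_
  dsimp only
  rw [eLpNorm_one_eq_lintegral_enorm, ← lintegral_const_mul' _ _ ENNReal.ofReal_ne_top,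
    ← lintegral_indicator hK]
  refine lintegral_mono fun x => ?_
  by_cases hx : x ∈ K
  · rw [Set.indicator_of_mem hx, ← map_sub]
    refine (ContinuousLinearMap.le_opENorm _ _).trans ?_
    gcongr
    · rw [← ofReal_norm]; exact ENNReal.ofReal_le_ofReal (hC x)
    · rfl
  · simp [hTK x hx]

end LocallyIntegrable

/-! ### Weak gradients: product rule and passage to the limit. -/

section WeakGradient

theorem integral_gradient_eq_zero {a : Rn N → ℝ} (ha : ContDiff ℝ 1 a)
    (hc : HasCompactSupport a) : ∫ x, ∇ a x = 0 := by
  have hi : Integrable (∇ a) volume :=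
    (continuous_gradient ha).integrable_of_hasCompactSupport (hasCompactSupport_gradient hc)
  refine ext_inner_left ℝ fun w => ?_
  rw [← integral_inner hi, inner_zero_right]
  have hd : ∀ x, inner ℝ w (∇ a x) = fderiv ℝ a x w := fun x => by
    rw [real_inner_comm, inner_gradient_left]
  simp_rw [hd]
  have hi2 : Integrable (fun x => fderiv ℝ a x w) volume := by
    simp_rw [← hd]
    exact hi.const_inner w
  -- Integration by parts against the constant function `1`.
  have := integral_mul_fderiv_eq_neg_fderiv_mul_of_integrable (μ := (volume : Measure (Rn N)))
    (𝕜 := ℝ) (f := fun _ => (1 : ℝ)) (g := a) (v := w) (by simp) (by simpa using hi2)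
    (by simpa using ha.continuous.integrable_of_hasCompactSupport hc)
    (fun _ _ => differentiableAt_const _)
    (fun x _ => (ha.differentiable one_ne_zero) x)
  simpa using this

/-- The classical gradient of a `C^1` function is its weak gradient. -/
theorem hasWeakGradient_of_contDiff {a : Rn N → ℝ} (ha : ContDiff ℝ 1 a) :
    HasWeakGradient a (∇ a) where
  locallyIntegrable := ha.continuous.locallyIntegrable
  locallyIntegrable_grad := (continuous_gradient ha).locallyIntegrable
  integral_eq φ hφ := by
    have hφ1 : ContDiff ℝ 1 φ := hφ.1.of_le (by simp)
    have h := integral_gradient_eq_zero (ha.mul hφ1) hφ.2.mul_left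
    have e : ∀ x, ∇ (fun y => a y * φ y) x = a x • ∇ φ x + φ x • ∇ a x := fun x =>
      gradient_mul (ha.differentiable one_ne_zero x) (hφ1.differentiable one_ne_zero x)
    have h' : ∫ x, (a x • ∇ φ x + φ x • ∇ a x) = 0 := by
      rw [← h]; exact integral_congr_ae (Eventually.of_forall fun x => (e x).symm)
    rw [integral_add] at h'
    · exact eq_neg_of_add_eq_zero_left h'
    · exact (ha.continuous.smul (continuous_gradient hφ1)).integrable_of_hasCompactSupport
        (hasCompactSupport_gradient hφ.2).smul_left
    · exact (hφ1.continuous.smul (continuous_gradient ha)).integrable_of_hasCompactSupport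
        hφ.2.smul_right

theorem HasWeakGradient.integrable_smul_gradient {u : Rn N → ℝ} {g : Rn N → Rn N}
    (h : HasWeakGradient u g) {φ : Rn N → ℝ} (hφ : φ ∈ testFunctions N) :
    Integrable (fun x => u x • ∇ φ x) volume :=
  h.locallyIntegrable.integrable_smul_right_of_hasCompactSupport
    (continuous_gradient (hφ.1.of_le (by simp))) (hasCompactSupport_gradient hφ.2)

theorem HasWeakGradient.integrable_smul {u : Rn N → ℝ} {g : Rn N → Rn N}
    (h : HasWeakGradient u g) {φ : Rn N → ℝ} (hφ : φ ∈ testFunctions N) :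
    Integrable (fun x => φ x • g x) volume :=
  h.locallyIntegrable_grad.integrable_smul_left_of_hasCompactSupport hφ.1.continuous hφ.2

theorem HasWeakGradient.sub {u u' : Rn N → ℝ} {g g' : Rn N → Rn N} (h : HasWeakGradient u g)
    (h' : HasWeakGradient u' g') : HasWeakGradient (u - u') (g - g') where
  locallyIntegrable := h.locallyIntegrable.sub h'.locallyIntegrable
  locallyIntegrable_grad := h.locallyIntegrable_grad.sub h'.locallyIntegrable_grad
  integral_eq φ hφ := by
    simp only [Pi.sub_apply, sub_smul, smul_sub]
    rw [integral_sub (h.integrable_smul_gradient hφ) (h'.integrable_smul_gradient hφ),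
      integral_sub (h.integrable_smul hφ) (h'.integrable_smul hφ), h.integral_eq φ hφ,
      h'.integral_eq φ hφ]
    abel

/-- Product rule with a smooth factor. -/
theorem HasWeakGradient.mul_smooth {u : Rn N → ℝ} {g : Rn N → Rn N} (h : HasWeakGradient u g)
    {η : Rn N → ℝ} (hη : ContDiff ℝ ∞ η) :
    HasWeakGradient (fun x => η x * u x) (fun x => η x • g x + u x • ∇ η x) where
  locallyIntegrable := LocallyIntegrable.smul_left_continuous h.locallyIntegrable hη.continuous
  locallyIntegrable_grad :=
    (LocallyIntegrable.smul_left_continuous h.locallyIntegrable_grad hη.continuous).add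
      (LocallyIntegrable.smul_right_continuous h.locallyIntegrable
        (continuous_gradient (hη.of_le (by simp))))
  integral_eq φ hφ := by
    have hη1 : ContDiff ℝ 1 η := hη.of_le (by simp)
    have hφ1 : ContDiff ℝ 1 φ := hφ.1.of_le (by simp)
    have hηφ : (fun x => η x * φ x) ∈ testFunctions N := ⟨hη.mul hφ.1, hφ.2.mul_left⟩
    have hi1 := h.integrable_smul_gradient hηφ
    have hi2 := h.integrable_smul hηφ
    have hi3 : Integrable (fun x => u x • (φ x • ∇ η x)) volume :=
      h.locallyIntegrable.integrable_smul_right_of_hasCompactSupport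
        (hφ1.continuous.smul (continuous_gradient hη1)) hφ.2.smul_right
    have e := h.integral_eq _ hηφ
    -- The weak identity for `u` is tested with `η φ`; the extra term `u φ ∇η` moves to the other
    -- side.
    calc ∫ x, (η x * u x) • ∇ φ x
        = ∫ x, (u x • ∇ (fun x => η x * φ x) x - u x • (φ x • ∇ η x)) := by
          refine integral_congr_ae (Eventually.of_forall fun x => ?_)
          simp only
          rw [gradient_mul (hη1.differentiable one_ne_zero x) (hφ1.differentiable one_ne_zero x)]
          module
      _ = - ∫ x, ((η x * φ x) • g x + u x • (φ x • ∇ η x)) := by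
          rw [integral_sub hi1 hi3, e, integral_add hi2 hi3]; abel
      _ = _ := by
          congr 1
          refine integral_congr_ae (Eventually.of_forall fun x => ?_)
          simp only
          module

/-- Weak gradients pass to the limit in `L^1_loc`. -/
theorem HasWeakGradient.of_tendsto {u : Rn N → ℝ} {g : Rn N → Rn N} {un : ℕ → Rn N → ℝ}
    {gn : ℕ → Rn N → Rn N} (hn : ∀ n, HasWeakGradient (un n) (gn n))
    (hu : LocallyIntegrable u volume) (hg : LocallyIntegrable g volume)
    (h1 : ∀ K, IsCompact K →
      Tendsto (fun n => eLpNorm (un n - u) 1 (volume.restrict K)) atTop (𝓝 0))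
    (h2 : ∀ K, IsCompact K →
      Tendsto (fun n => eLpNorm (gn n - g) 1 (volume.restrict K)) atTop (𝓝 0)) :
    HasWeakGradient u g where
  locallyIntegrable := hu
  locallyIntegrable_grad := hg
  integral_eq φ hφ := by
    have hφ1 : ContDiff ℝ 1 φ := hφ.1.of_le (by simp)
    have hgc := continuous_gradient hφ1
    have hgs := hasCompactSupport_gradient hφ.2
    obtain ⟨C, hC⟩ := hgs.exists_bound_of_continuous hgc
    obtain ⟨D, hD⟩ := hφ.2.exists_bound_of_continuous hφ1.continuous
    have t1 := tendsto_integral_of_eLpNorm_restrict (isClosed_tsupport _).measurableSet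
      (h1 _ hgs) (fun x => ContinuousLinearMap.toSpanSingleton ℝ (∇ φ x)) (C := C)
      (fun x => by simpa using hC x)
      (fun x hx => by rw [image_eq_zero_of_notMem_tsupport hx]; simp)
      (fun n => by simpa using (hn n).integrable_smul_gradient hφ)
      (by simpa using hu.integrable_smul_right_of_hasCompactSupport hgc hgs)
    have t2 := tendsto_integral_of_eLpNorm_restrict (isClosed_tsupport _).measurableSet
      (h2 _ hφ.2) (fun x => φ x • ContinuousLinearMap.id ℝ (Rn N)) (C := D)
      (fun x => (norm_smul (φ x) _).le.trans
        ((mul_le_of_le_one_right (norm_nonneg _) ContinuousLinearMap.norm_id_le).trans (hD x)))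
      (fun x hx => by rw [image_eq_zero_of_notMem_tsupport hx]; simp)
      (fun n => by simpa using (hn n).integrable_smul hφ)
      (by simpa using hg.integrable_smul_left_of_hasCompactSupport hφ1.continuous hφ.2)
    simp only [ContinuousLinearMap.toSpanSingleton_apply, smul_apply,
      ContinuousLinearMap.id_apply] at t1 t2
    refine tendsto_nhds_unique t1 (t2.neg.congr fun n => ?_)
    rw [(hn n).integral_eq φ hφ]

end WeakGradient

/-! ### Mollification in `ℝ^N` and the chain rule for weak gradients. -/

section Mollify

variable {F : Type*} [NormedAddCommGroup F] [NormedSpace ℝ F]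

/-- A sequence of bump functions concentrating at the origin. -/
noncomputable def mollifier (N n : ℕ) : ContDiffBump (0 : Rn N) where
  -- The fixed ratio `rOut = 2 rIn` gives almost everywhere convergence in `ae_tendsto_mollify`.
  rIn := 1 / (2 * ((n : ℝ) + 1))
  rOut := 1 / ((n : ℝ) + 1)
  rIn_pos := by positivity
  rIn_lt_rOut := by
    apply one_div_lt_one_div_of_lt <;> linarith [n.cast_nonneg (α := ℝ)]

theorem tendsto_mollifier_rOut (N : ℕ) : Tendsto (fun n => (mollifier N n).rOut) atTop (𝓝 0) :=
  tendsto_one_div_add_atTop_nhds_zero_nat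

/-- Mollification of a function on `ℝ^N`. -/
noncomputable def mollify (n : ℕ) (f : Rn N → F) : Rn N → F :=
  (mollifier N n).normed volume ⋆[lsmul ℝ ℝ, volume] f

theorem mollify_apply (n : ℕ) (f : Rn N → F) (x : Rn N) :
    mollify n f x = ∫ t, (mollifier N n).normed volume (x - t) • f t := by
  simp [mollify, convolution_eq_swap]

theorem ae_tendsto_mollify [CompleteSpace F] {f : Rn N → F} (hf : LocallyIntegrable f volume) :
    ∀ᵐ x, Tendsto (fun n => mollify n f x) atTop (𝓝 (f x)) :=
  ContDiffBump.ae_convolution_tendsto_right_of_locallyIntegrable (K := 2)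
    (tendsto_mollifier_rOut N)
    (Eventually.of_forall fun n => le_of_eq (by simp only [mollifier]; field_simp)) hf

theorem tendsto_eLpNorm_mollify_sub [CompleteSpace F] {p : ℝ≥0∞} (hp1 : 1 ≤ p) (hp : p ≠ ⊤)
    {f : Rn N → F} (hf : MemLp f p volume) :
    Tendsto (fun n => eLpNorm (mollify n f - f) p volume) atTop (𝓝 0) :=
  tendsto_eLpNorm_convolution_sub volume hp1 hp hf (tendsto_mollifier_rOut N)

theorem tendsto_eLpNorm_restrict_mollify_sub [CompleteSpace F] {f : Rn N → F}
    (hf : LocallyIntegrable f volume) {K : Set (Rn N)} (hK : IsCompact K) :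
    Tendsto (fun n => eLpNorm (mollify n f - f) 1 (volume.restrict K)) atTop (𝓝 0) :=
  tendsto_eLpNorm_restrict_convolution_sub volume hf (tendsto_mollifier_rOut N) hK

theorem contDiff_mollify [CompleteSpace F] (n : ℕ) {f : Rn N → F}
    (hf : LocallyIntegrable f volume) : ContDiff ℝ ∞ (mollify n f) :=
  (mollifier N n).hasCompactSupport_normed.contDiff_convolution_left _
    (mollifier N n).contDiff_normed hf

theorem hasCompactSupport_mollify (n : ℕ) {f : Rn N → F} (hf : HasCompactSupport f) :
    HasCompactSupport (mollify n f) :=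
  (mollifier N n).hasCompactSupport_normed.convolution _ hf

/-- Mollification commutes with the gradient. -/
theorem HasWeakGradient.gradient_mollify {u : Rn N → ℝ} {g : Rn N → Rn N}
    (h : HasWeakGradient u g) (n : ℕ) : ∇ (mollify n u) = mollify n g := by
  set ρ : Rn N → ℝ := (mollifier N n).normed volume with hρ
  have hρs : ContDiff ℝ ∞ ρ := (mollifier N n).contDiff_normed
  have hρc : HasCompactSupport ρ := (mollifier N n).hasCompactSupport_normed
  have hρ1 : ContDiff ℝ 1 ρ := hρs.of_le (by simp)
  refine gradient_eq fun x => ?_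
  -- The kernel centred at `x` is itself a test function; the sign from differentiating `x - t`
  -- cancels the sign in the weak identity.
  have hφ : (fun t => ρ (x - t)) ∈ testFunctions N :=
    ⟨hρs.comp (contDiff_const.sub contDiff_id),
      hρc.comp_homeomorph (Homeomorph.subLeft x)⟩
  have hφg : ∀ t, ∇ (fun t => ρ (x - t)) t = - ∇ ρ (x - t) := by
    intro t
    have := ((hρ1.differentiable one_ne_zero (x - t)).hasFDerivAt.comp t
      ((hasFDerivAt_id t).const_sub x)).fderiv
    simp only [Function.comp_def] at this
    simp [gradient, this, ContinuousLinearMap.comp_neg]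
  have hint := h.integrable_smul_gradient hφ
  have e := h.integral_eq _ hφ
  rw [← mollify_apply n g x] at e
  have e' : mollify n g x = ∫ t, u t • ∇ ρ (x - t) := by
    rw [← neg_injective.eq_iff, ← e, ← integral_neg]
    exact integral_congr_ae (Eventually.of_forall fun t => by simp only [hφg, smul_neg])
  have hint' : Integrable (fun t => u t • ∇ ρ (x - t)) volume := by
    refine hint.neg.congr (Eventually.of_forall fun t => ?_)
    simp [hφg]
  rw [hasGradientAt_iff_hasFDerivAt]
  refine (hρc.hasFDerivAt_convolution_left (lsmul ℝ ℝ) hρ1 h.locallyIntegrable x).congr_fderiv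
    (Eq.symm ?_)
  refine ContinuousLinearMap.ext fun w => ?_
  rw [InnerProductSpace.toDual_apply_apply, e', real_inner_comm, ← integral_inner hint',
    convolution_eq_swap, ContinuousLinearMap.integral_apply]
  · refine integral_congr_ae (Eventually.of_forall fun t => ?_)
    simp [inner_smul_right, mul_comm]
  · have := (hρc.fderiv ℝ).convolutionExists_left ((lsmul ℝ ℝ : ℝ →L[ℝ] ℝ →L[ℝ] ℝ).precompL (Rn N))
      (hρ1.continuous_fderiv one_ne_zero) h.locallyIntegrable x
    exact this.integrable_swap

/-- Chain rule for a `C^1` function with derivative bounded by one. -/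
theorem HasWeakGradient.comp {u : Rn N → ℝ} {g : Rn N → Rn N} (h : HasWeakGradient u g)
    {f f' : ℝ → ℝ} (hf : ∀ t, HasDerivAt f (f' t) t) (hf' : Continuous f')
    (hb : ∀ t, |f' t| ≤ 1) :
    HasWeakGradient (fun x => f (u x)) (fun x => f' (u x) • g x) := by
  have hu := h.locallyIntegrable
  have hg := h.locallyIntegrable_grad
  have hfc : ContDiff ℝ 1 f := by
    rw [contDiff_one_iff_deriv]
    exact ⟨fun t => (hf t).differentiableAt, by rwa [funext fun t => (hf t).deriv]⟩
  have hlip : ∀ s t, ‖f s - f t‖ ≤ ‖s - t‖ := fun s t => by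
    simpa using Convex.norm_image_sub_le_of_norm_hasDerivWithin_le (C := 1)
      (fun y _ => (hf y).hasDerivWithinAt) (fun y _ => hb y) convex_univ (Set.mem_univ t)
      (Set.mem_univ s)
  have hm1 : ∀ n, ContDiff ℝ 1 (mollify n u) := fun n => (contDiff_mollify n hu).of_le (by simp)
  have hfu : LocallyIntegrable (fun x => f (u x)) volume := by
    have hc : LocallyIntegrable (fun x => ‖u x‖ + ‖f 0‖) (volume : Measure (Rn N)) :=
      LocallyIntegrable.add (fun x => (hu x).norm) (locallyIntegrable_const _)
    refine hc.mono (hfc.continuous.comp_aestronglyMeasurable hu.aestronglyMeasurable)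
      (Eventually.of_forall fun x => ?_)
    rw [Real.norm_of_nonneg (by positivity : 0 ≤ ‖u x‖ + ‖f 0‖)]
    have := hlip (u x) 0
    rw [sub_zero] at this
    linarith [norm_sub_norm_le (f (u x)) (f 0)]
  have hfum : AEStronglyMeasurable (fun x => f' (u x)) (volume : Measure (Rn N)) :=
    hf'.comp_aestronglyMeasurable hu.aestronglyMeasurable
  have hfg : LocallyIntegrable (fun x => f' (u x) • g x) volume := by
    refine hg.mono (hfum.smul hg.aestronglyMeasurable) (Eventually.of_forall fun x => ?_)
    rw [norm_smul]
    exact mul_le_of_le_one_left (norm_nonneg _) (hb _)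
  refine HasWeakGradient.of_tendsto (un := fun n x => f (mollify n u x))
    (gn := fun n x => f' (mollify n u x) • mollify n g x) (fun n => ?_) hfu hfg
    (fun K hK => ?_) (fun K hK => ?_)
  · have e : (fun x => f' (mollify n u x) • mollify n g x) = ∇ (fun x => f (mollify n u x)) := by
      funext x
      rw [gradient_comp (hf _) ((hm1 n).differentiable one_ne_zero x), h.gradient_mollify n]
    rw [e]
    exact hasWeakGradient_of_contDiff (hfc.comp (hm1 n))
  · refine tendsto_of_tendsto_of_tendsto_of_le_of_le tendsto_const_nhds
      (tendsto_eLpNorm_restrict_mollify_sub hu hK) (fun _ => zero_le) fun n => ?_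
    exact eLpNorm_mono fun x => hlip _ _
  -- With `u_n`, `g_n` the mollifications, the error is `f'(u_n)(g_n - g) + (f'(u_n) - f'(u)) g`.
  -- The second term is treated here by dominated convergence with majorant `2|g|`; the first is at
  -- most `|g_n - g|`.
  · have ha : Tendsto (fun n => eLpNorm (fun x => (f' (mollify n u x) - f' (u x)) • g x) 1
        (volume.restrict K)) atTop (𝓝 0) := by
      simp_rw [eLpNorm_one_eq_lintegral_enorm]
      have hgK : Integrable g (volume.restrict K) := hg.integrableOn_isCompact hK
      rw [← lintegral_zero (μ := volume.restrict K)]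
      refine tendsto_lintegral_of_dominated_convergence' (fun x => 2 * ‖g x‖ₑ) (fun n => ?_)
        (fun n => Eventually.of_forall fun x => ?_) ?_ ?_
      · exact ((((hf'.comp (hm1 n).continuous).aestronglyMeasurable).sub hfum.restrict).smul
          hgK.aestronglyMeasurable).enorm
      · simp only [enorm_smul]
        gcongr
        rw [← ofReal_norm, Real.norm_eq_abs, ← ENNReal.ofReal_ofNat]
        refine ENNReal.ofReal_le_ofReal ((abs_sub _ _).trans ?_)
        linarith [hb (mollify n u x), hb (u x)]
      · rw [lintegral_const_mul' _ _ (by simp)]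
        exact ENNReal.mul_ne_top (by simp) hgK.2.ne
      · filter_upwards [ae_restrict_of_ae (ae_tendsto_mollify hu)] with x hx
        have := (((hf'.tendsto _).comp hx).sub_const (f' (u x))).smul_const (g x)
        simpa using this.enorm
    have hb' := (tendsto_eLpNorm_restrict_mollify_sub hg hK).add ha
    rw [add_zero] at hb'
    refine tendsto_of_tendsto_of_tendsto_of_le_of_le tendsto_const_nhds hb' (fun _ => zero_le)
      fun n => ?_
    have e : ((fun x => f' (mollify n u x) • mollify n g x) - fun x => f' (u x) • g x) =
        (fun x => f' (mollify n u x) • (mollify n g - g) x) +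
          fun x => (f' (mollify n u x) - f' (u x)) • g x := by
      funext x
      simp only [Pi.sub_apply, Pi.add_apply]
      module
    dsimp only
    rw [e]
    have hmc : AEStronglyMeasurable (fun x => f' (mollify n u x)) (volume.restrict K) :=
      (hf'.comp (hm1 n).continuous).aestronglyMeasurable
    refine (eLpNorm_add_le ?_ ?_ le_rfl).trans (add_le_add ?_ le_rfl)
    · exact hmc.smul ((contDiff_mollify n hg).continuous.aestronglyMeasurable.sub
        hg.aestronglyMeasurable.restrict)
    · exact (hmc.sub hfum.restrict).smul hg.aestronglyMeasurable.restrict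
    · refine eLpNorm_mono fun x => ?_
      rw [norm_smul]
      exact mul_le_of_le_one_left (norm_nonneg _) (hb _)

end Mollify

/-! ### Bounds for the density `μ_N` and for `∇v_N`. -/

section Weights

theorem unitBallVolume_pos (N : ℕ) : 0 < unitBallVolume N :=
  ENNReal.toReal_pos (Metric.measure_ball_pos _ _ one_pos).ne' measure_ball_lt_top.ne

theorem one_lt_conjExponent (hN : 2 ≤ N) : 1 < (N : ℝ) / ((N : ℝ) - 1) := by
  have : (2 : ℝ) ≤ N := by exact_mod_cast hN
  rw [one_lt_div (by linarith)]
  linarith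

theorem muDensity_denom_pos (N : ℕ) (x : Rn N) :
    0 < unitBallVolume N * (1 + ‖x‖ ^ ((N : ℝ) / ((N : ℝ) - 1))) ^ N :=
  mul_pos (unitBallVolume_pos N) (by positivity)

theorem muDensity_pos (N : ℕ) (x : Rn N) : 0 < muDensity N x :=
  one_div_pos.2 (muDensity_denom_pos N x)

theorem muDensity_le (N : ℕ) (x : Rn N) : muDensity N x ≤ 1 / unitBallVolume N := by
  refine one_div_le_one_div_of_le (unitBallVolume_pos N) ?_
  refine le_mul_of_one_le_right (unitBallVolume_pos N).le (one_le_pow₀ ?_)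
  linarith [Real.rpow_nonneg (norm_nonneg x) ((N : ℝ) / ((N : ℝ) - 1))]

theorem continuous_muDensity (hN : 2 ≤ N) : Continuous (muDensity N) := by
  refine continuous_const.div ?_ fun x => (muDensity_denom_pos N x).ne'
  refine continuous_const.mul ((continuous_const.add ?_).pow _)
  exact continuous_norm.rpow_const fun x => Or.inr (zero_le_one.trans (one_lt_conjExponent hN).le)

theorem mu_le (N : ℕ) :
    mu N ≤ ENNReal.ofReal (1 / unitBallVolume N) • (volume : Measure (Rn N)) := by
  rw [← withDensity_const]
  exact withDensity_mono (Eventually.of_forall fun x =>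
    ENNReal.ofReal_le_ofReal (muDensity_le N x))

/-- On compact sets Lebesgue measure is controlled by `μ_N`. -/
theorem exists_restrict_volume_le_mu (hN : 2 ≤ N) {K : Set (Rn N)} (hK : IsCompact K) :
    ∃ C : ℝ≥0∞, C ≠ ⊤ ∧ (volume : Measure (Rn N)).restrict K ≤ C • mu N := by
  -- `C` bounds `1/μ_N` on `K`, which is continuous because `μ_N` is continuous and positive.
  obtain ⟨C, hC⟩ := hK.exists_bound_of_continuousOn (f := fun x => (muDensity N x)⁻¹)
    ((continuous_muDensity hN).inv₀ fun x => (muDensity_pos N x).ne').continuousOn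
  refine ⟨ENNReal.ofReal C, ENNReal.ofReal_ne_top, Measure.le_iff.2 fun s hs => ?_⟩
  rw [Measure.restrict_apply hs, Measure.smul_apply, mu, withDensity_apply _ hs, smul_eq_mul,
    ← lintegral_const_mul' _ _ ENNReal.ofReal_ne_top, ← setLIntegral_one]
  have h1 : ∫⁻ _ in s ∩ K, 1 ≤ ∫⁻ x in s ∩ K, ENNReal.ofReal C * ENNReal.ofReal (muDensity N x) := by
    refine setLIntegral_mono' (hs.inter hK.measurableSet) fun x hx => ?_
    have hx' := hC x hx.2
    have hp := muDensity_pos N x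
    rw [Real.norm_of_nonneg (inv_nonneg.2 hp.le)] at hx'
    rw [← ENNReal.ofReal_mul ((inv_nonneg.2 hp.le).trans hx'), ← ENNReal.ofReal_one]
    refine ENNReal.ofReal_le_ofReal ?_
    rwa [inv_le_iff_one_le_mul₀ hp] at hx'
  exact h1.trans (lintegral_mono_set Set.inter_subset_left)

/-- Up to a constant, `v_N` is `-N ln(1 + |x|^a)` with `a = N/(N-1)`. Since `a > 1`, `|x|^a` is
differentiable at the origin too, so no point is exceptional. The proof yields equality. -/
theorem norm_gradient_v_le (hN : 2 ≤ N) (x : Rn N) :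
    ‖∇ (v N) x‖ ≤ N * ((N : ℝ) / ((N : ℝ) - 1)) *
      (‖x‖ ^ ((N : ℝ) / ((N : ℝ) - 1) - 1) / (1 + ‖x‖ ^ ((N : ℝ) / ((N : ℝ) - 1)))) := by
  set a : ℝ := (N : ℝ) / ((N : ℝ) - 1) with ha
  have ha1 : 1 < a := one_lt_conjExponent hN
  have hs : ∀ y : Rn N, 0 < 1 + ‖y‖ ^ a := fun y => by positivity
  have hv : v N = fun y : Rn N => -Real.log (unitBallVolume N) - N * Real.log (1 + ‖y‖ ^ a) := by
    funext y
    rw [v, muDensity, one_div, Real.log_inv, Real.log_mul (unitBallVolume_pos N).ne'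
      (pow_pos (hs y) N).ne', Real.log_pow]
    ring
  have hd : HasFDerivAt (v N) (-((N : ℝ) • ((1 + ‖x‖ ^ a)⁻¹ •
      fderiv ℝ (fun y : Rn N => ‖y‖ ^ a) x))) x := by
    rw [hv]
    have h0 : DifferentiableAt ℝ (fun y : Rn N => ‖y‖ ^ a) x :=
      (differentiable_norm_rpow ha1) x
    exact (((h0.hasFDerivAt.const_add 1).log (hs x).ne').const_mul _).const_sub _
  rw [norm_gradient, hd.fderiv, norm_neg, norm_smul, norm_smul, norm_fderiv_norm_id_rpow x ha1,
    Real.norm_of_nonneg (Nat.cast_nonneg N), Real.norm_of_nonneg (inv_nonneg.2 (hs x).le)]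
  refine le_of_eq ?_
  field_simp

/-- `|∇v_N|` is bounded and decays like `1/|x|`. -/
theorem exists_norm_gradient_v_le (hN : 2 ≤ N) :
    ∃ D : ℝ, 0 ≤ D ∧ ∀ x : Rn N, ‖∇ (v N) x‖ ≤ D ∧ ‖∇ (v N) x‖ * ‖x‖ ≤ D := by
  set a : ℝ := (N : ℝ) / ((N : ℝ) - 1) with ha
  have ha1 : 1 < a := one_lt_conjExponent hN
  have hD : 0 ≤ N * a := by positivity
  refine ⟨N * a, hD, fun x => ?_⟩
  have hs : 0 < 1 + ‖x‖ ^ a := by positivity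
  have h := norm_gradient_v_le hN x
  rw [← ha] at h
  constructor
  · refine h.trans (mul_le_of_le_one_right hD ((div_le_one hs).2 ?_))
    rcases le_total ‖x‖ 1 with h1 | h1
    · have := Real.rpow_le_one (norm_nonneg x) h1 (by linarith : 0 ≤ a - 1)
      linarith [Real.rpow_nonneg (norm_nonneg x) a]
    · have := Real.rpow_le_rpow_of_exponent_le h1 (by linarith : a - 1 ≤ a)
      linarith
  · refine (mul_le_mul_of_nonneg_right h (norm_nonneg x)).trans ?_
    rw [mul_assoc]
    refine mul_le_of_le_one_right hD ?_
    rw [div_mul_eq_mul_div, div_le_one hs]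
    rcases (norm_nonneg x).eq_or_lt with h0 | h0
    · rw [← h0]; simp; positivity
    · rw [← Real.rpow_add_one h0.ne', sub_add_cancel]; linarith

/-- The measure `|∇v_N|^{N-2} dx`. -/
noncomputable def nu (N : ℕ) : Measure (Rn N) :=
  (volume : Measure (Rn N)).withDensity (fun x => ‖∇ (v N) x‖ₑ ^ (N - 2))

theorem measurable_gradient (a : Rn N → ℝ) : Measurable (∇ a) :=
  (InnerProductSpace.toDual ℝ (Rn N)).symm.continuous.measurable.comp (measurable_fderiv ℝ a)

theorem measurable_nu_density (N : ℕ) :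
    Measurable (fun x : Rn N => ‖∇ (v N) x‖ₑ ^ (N - 2)) :=
  (measurable_gradient _).enorm.pow_const _

/-- Because `∇v_N` is bounded, convergence in `L²(dx)` implies convergence in `L²(ν)`; this serves
for compactly supported functions. -/
theorem exists_nu_le (hN : 2 ≤ N) :
    ∃ C : ℝ≥0∞, C ≠ ⊤ ∧ nu N ≤ C • (volume : Measure (Rn N)) := by
  obtain ⟨D, -, hD⟩ := exists_norm_gradient_v_le hN
  refine ⟨ENNReal.ofReal D ^ (N - 2), by finiteness, ?_⟩
  rw [← withDensity_const]
  refine withDensity_mono (Eventually.of_forall fun x => ?_)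
  dsimp only
  gcongr
  rw [← ofReal_norm]
  exact ENNReal.ofReal_le_ofReal (hD x).1

end Weights

/-! ### Logarithmic cutoffs and their vanishing gradient energy. -/

section Cutoff

/-- The logarithmic cutoff, equal to `1` where `ln(1+|x|²) ≤ n+1` and to `0` where
`ln(1+|x|²) ≥ 2(n+1)`. -/
noncomputable def cutoff (N n : ℕ) (x : Rn N) : ℝ :=
  -- Using `1 + |x|²` instead of `|x|` keeps the logarithm smooth at the origin.
  Real.smoothTransition (2 - Real.log (1 + ‖x‖ ^ 2) / ((n : ℝ) + 1))

theorem contDiff_log_one_add_norm_sq :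
    ContDiff ℝ ∞ (fun x : Rn N => Real.log (1 + ‖x‖ ^ 2)) :=
  (contDiff_const.add (contDiff_norm_sq ℝ)).log fun x => by positivity

theorem contDiff_cutoff (N n : ℕ) : ContDiff ℝ ∞ (cutoff N n) :=
  Real.smoothTransition.contDiff.comp
    (contDiff_const.sub (contDiff_log_one_add_norm_sq.div_const _))

theorem cutoff_nonneg (n : ℕ) (x : Rn N) : 0 ≤ cutoff N n x := Real.smoothTransition.nonneg _

theorem cutoff_le_one (n : ℕ) (x : Rn N) : cutoff N n x ≤ 1 := Real.smoothTransition.le_one _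

theorem two_mul_lt_log_of_exp_lt {n : ℕ} {x : Rn N} (h : Real.exp ((n : ℝ) + 1) < ‖x‖) :
    2 * ((n : ℝ) + 1) < Real.log (1 + ‖x‖ ^ 2) := by
  rw [Real.lt_log_iff_exp_lt (by positivity), two_mul, Real.exp_add]
  nlinarith [Real.exp_pos ((n : ℝ) + 1)]

theorem hasCompactSupport_cutoff (N n : ℕ) : HasCompactSupport (cutoff N n) := by
  refine HasCompactSupport.intro (isCompact_closedBall 0 (Real.exp ((n : ℝ) + 1))) fun x hx => ?_
  rw [mem_closedBall_zero_iff, not_le] at hx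
  refine Real.smoothTransition.zero_of_nonpos ?_
  have hn : (0 : ℝ) < (n : ℝ) + 1 := by positivity
  rw [sub_nonpos, le_div_iff₀ hn]
  exact (two_mul_lt_log_of_exp_lt hx).le

theorem tendsto_cutoff (x : Rn N) : Tendsto (fun n => cutoff N n x) atTop (𝓝 1) := by
  refine tendsto_const_nhds.congr' ?_
  filter_upwards [(tendsto_natCast_atTop_atTop (R := ℝ)).eventually_ge_atTop
    (Real.log (1 + ‖x‖ ^ 2))] with n hn
  refine (Real.smoothTransition.one_of_one_le ?_).symm
  have h0 : (0 : ℝ) < (n : ℝ) + 1 := by positivity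
  have : Real.log (1 + ‖x‖ ^ 2) / ((n : ℝ) + 1) ≤ 1 := by
    rw [div_le_one h0]; linarith
  linarith

theorem exists_abs_deriv_smoothTransition_le :
    ∃ C : ℝ, 0 ≤ C ∧ (∀ t, |deriv Real.smoothTransition t| ≤ C) ∧
      ∀ t, t ∉ Set.Icc (0 : ℝ) 1 → deriv Real.smoothTransition t = 0 := by
  have hc : Continuous (deriv Real.smoothTransition) :=
    (Real.smoothTransition.contDiff (n := 1)).continuous_deriv le_rfl
  obtain ⟨C, hC⟩ := (isCompact_Icc (a := (0 : ℝ)) (b := 1)).exists_bound_of_continuousOn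
    hc.continuousOn
  have h0 : ∀ t, t ∉ Set.Icc (0 : ℝ) 1 → deriv Real.smoothTransition t = 0 := by
    intro t ht
    rw [Set.mem_Icc, not_and_or, not_le, not_le] at ht
    rcases ht with ht | ht
    · have : Real.smoothTransition =ᶠ[𝓝 t] fun _ => 0 := by
        filter_upwards [gt_mem_nhds ht] with s hs
        exact Real.smoothTransition.zero_of_nonpos hs.le
      rw [this.deriv_eq, deriv_const]
    · have : Real.smoothTransition =ᶠ[𝓝 t] fun _ => 1 := by
        filter_upwards [lt_mem_nhds ht] with s hs
        exact Real.smoothTransition.one_of_one_le hs.le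
      rw [this.deriv_eq, deriv_const]
  have hC0 : 0 ≤ C := (norm_nonneg _).trans (hC 0 (by simp))
  refine ⟨C, hC0, fun t => ?_, h0⟩
  by_cases ht : t ∈ Set.Icc (0 : ℝ) 1
  · exact hC t ht
  · rw [h0 t ht, abs_zero]; exact hC0

/-- The inner function has gradient of size at most `2|x|/((n+1)(1+|x|²)) ≤ 2/((n+1)|x|)`. In the
unit ball `ln(1+|x|²) ≤ ln 2 < n+1`, and beyond `e^{n+1}` the logarithm exceeds `2(n+1)`: in both
regions the cutoff is locally constant. `C` does not depend on `n`. -/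
theorem exists_norm_gradient_cutoff_le (N : ℕ) :
    ∃ C : ℝ, 0 ≤ C ∧ ∀ (n : ℕ) (x : Rn N), ‖∇ (cutoff N n) x‖ ≤ C / ((n : ℝ) + 1) *
      (Set.Icc 1 (Real.exp ((n : ℝ) + 1))).indicator (fun r => r⁻¹) ‖x‖ := by
  obtain ⟨C, hC0, hC, hz⟩ := exists_abs_deriv_smoothTransition_le
  refine ⟨2 * C, by positivity, fun n x => ?_⟩
  have hn : (0 : ℝ) < (n : ℝ) + 1 := by positivity
  have hs : 0 < 1 + ‖x‖ ^ 2 := by positivity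
  set q : Rn N → ℝ := fun x => 2 - Real.log (1 + ‖x‖ ^ 2) / ((n : ℝ) + 1) with hq
  have hqd : DifferentiableAt ℝ q x :=
    (contDiff_const.sub (contDiff_log_one_add_norm_sq.div_const _)).differentiable (n := ∞)
      (by simp) x
  have hg : ∇ (cutoff N n) x = deriv Real.smoothTransition (q x) • ∇ q x :=
    gradient_comp ((Real.smoothTransition.contDiff (n := 1)).differentiable one_ne_zero
      (q x)).hasDerivAt hqd
  have hgq : ‖∇ q x‖ ≤ 2 / ((n : ℝ) + 1) * (‖x‖ / (1 + ‖x‖ ^ 2)) := by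
    have h1 := ((((hasStrictFDerivAt_norm_sq x).hasFDerivAt.const_add 1).log hs.ne').mul_const
      ((n : ℝ) + 1)⁻¹).const_sub 2
    rw [norm_gradient, show q = fun x => 2 - Real.log (1 + ‖x‖ ^ 2) * ((n : ℝ) + 1)⁻¹ from rfl,
      h1.fderiv, norm_neg, norm_smul, norm_smul, Real.norm_of_nonneg (inv_nonneg.2 hn.le),
      Real.norm_of_nonneg (inv_nonneg.2 hs.le)]
    have h2 : ‖(2 : ℕ) • innerSL ℝ x‖ ≤ 2 * ‖x‖ := by
      refine (norm_nsmul_le).trans ?_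
      simp
    calc _ ≤ ((n : ℝ) + 1)⁻¹ * ((1 + ‖x‖ ^ 2)⁻¹ * (2 * ‖x‖)) := by gcongr
      _ = _ := by field_simp
  by_cases hx : ‖x‖ ∈ Set.Icc 1 (Real.exp ((n : ℝ) + 1))
  · rw [Set.indicator_of_mem hx, hg, norm_smul]
    have hx0 : 0 < ‖x‖ := zero_lt_one.trans_le hx.1
    have h3 : ‖x‖ / (1 + ‖x‖ ^ 2) ≤ ‖x‖⁻¹ := by
      rw [div_le_iff₀ hs, inv_mul_eq_div, le_div_iff₀ hx0]
      nlinarith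
    calc _ ≤ C * (2 / ((n : ℝ) + 1) * ‖x‖⁻¹) := by
          refine mul_le_mul (hC _) (hgq.trans ?_) (norm_nonneg _) hC0
          gcongr
      _ = _ := by ring
  · rw [Set.indicator_of_notMem hx, mul_zero, hg, hz, zero_smul, norm_zero]
    rw [Set.mem_Icc, not_and_or, not_le, not_le] at hx ⊢
    rcases hx with hx | hx
    · right
      have h4 : Real.log (1 + ‖x‖ ^ 2) < (n : ℝ) + 1 := by
        have : Real.log (1 + ‖x‖ ^ 2) ≤ Real.log 2 :=
          Real.log_le_log hs (by nlinarith [norm_nonneg x])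
        linarith [Real.log_two_lt_d9, n.cast_nonneg (α := ℝ)]
      have : Real.log (1 + ‖x‖ ^ 2) / ((n : ℝ) + 1) < 1 := (div_lt_one hn).2 h4
      simp only [hq]; linarith
    · left
      rw [hq, sub_neg, lt_div_iff₀ hn]
      exact two_mul_lt_log_of_exp_lt hx

/-- `∫_{1 ≤ |x| ≤ R} |x|^{-N} dx = N V_N ln R`. -/
theorem lintegral_annulus (hN : 2 ≤ N) {R : ℝ} (hR : 1 ≤ R) :
    ∫⁻ x : Rn N, ENNReal.ofReal ((Set.Icc 1 R).indicator (fun r => (r ^ N)⁻¹) ‖x‖) =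
      ENNReal.ofReal (N * unitBallVolume N * Real.log R) := by
  set f : ℝ → ℝ := (Set.Icc 1 R).indicator (fun r => (r ^ N)⁻¹) with hf
  have : Nonempty (Fin N) := ⟨⟨0, by omega⟩⟩
  have hdim : Module.finrank ℝ (Rn N) = N := finrank_euclideanSpace_fin
  -- In polar coordinates the Jacobian `r^{N-1}` turns `r^{-N}` into `r^{-1}`, whose integral is the
  -- logarithm.
  have hfi : ∀ y : ℝ, y ^ (N - 1) • f y = (Set.Icc 1 R).indicator (fun r => r⁻¹) y := by
    intro y
    by_cases hy : y ∈ Set.Icc 1 R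
    · have hy0 : y ≠ 0 := (zero_lt_one.trans_le hy.1).ne'
      rw [hf, Set.indicator_of_mem hy, Set.indicator_of_mem hy, smul_eq_mul]
      obtain ⟨m, rfl⟩ : ∃ m, N = m + 1 := ⟨N - 1, by omega⟩
      rw [Nat.add_sub_cancel]
      field_simp
      exact (pow_succ y m).symm
    · rw [hf, Set.indicator_of_notMem hy, Set.indicator_of_notMem hy, smul_zero]
  have hint : IntegrableOn (fun r : ℝ => r⁻¹) (Set.Icc 1 R) :=
    (continuousOn_inv₀.mono fun r hr => (zero_lt_one.trans_le hr.1).ne').integrableOn_Icc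
  have hfint : Integrable (fun x : Rn N => f ‖x‖) := by
    rw [integrable_fun_norm_addHaar, hdim]
    simp_rw [hfi]
    exact ((integrable_indicator_iff measurableSet_Icc).2 hint).integrableOn
  rw [← ofReal_integral_eq_lintegral_ofReal hfint (Eventually.of_forall fun x =>
    Set.indicator_nonneg (fun r hr => inv_nonneg.2 (pow_nonneg (zero_le_one.trans hr.1) _)) _),
    integral_fun_norm_addHaar, hdim]
  simp_rw [hfi]
  have hs : Set.Ioi (0 : ℝ) ∩ Set.Icc 1 R = Set.Icc 1 R :=
    Set.inter_eq_right.2 fun r hr => zero_lt_one.trans_le hr.1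
  rw [setIntegral_indicator measurableSet_Icc, hs, integral_Icc_eq_integral_Ioc,
    ← intervalIntegral.integral_of_le hR, integral_inv_of_pos one_pos (zero_lt_one.trans_le hR),
    div_one, nsmul_eq_mul, smul_eq_mul, ← mul_assoc, unitBallVolume]

/-- The gradients of the logarithmic cutoffs vanish asymptotically in all the weighted norms
interpolating between `L^N(dx)` and `L²(|∇v_N|^{N-2} dx)`. -/
theorem tendsto_lintegral_gradient_cutoff (hN : 2 ≤ N) {k : ℕ} (hk : 2 ≤ k) (hkN : k ≤ N) :
    Tendsto (fun n => ∫⁻ x : Rn N, ‖∇ (cutoff N n) x‖ₑ ^ k * ‖∇ (v N) x‖ₑ ^ (N - k))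
      atTop (𝓝 0) := by
  obtain ⟨C, hC0, hC⟩ := exists_norm_gradient_cutoff_le N
  obtain ⟨D, hD0, hD⟩ := exists_norm_gradient_v_le hN
  set M : ℝ := C ^ k * D ^ (N - k) * (N * unitBallVolume N)
  have hlim : Tendsto (fun n : ℕ => ENNReal.ofReal (M * (1 / ((n : ℝ) + 1)))) atTop (𝓝 0) := by
    rw [← ENNReal.ofReal_zero]
    refine ENNReal.tendsto_ofReal ?_
    simpa using (tendsto_one_div_add_atTop_nhds_zero_nat (𝕜 := ℝ)).const_mul M
  refine tendsto_of_tendsto_of_tendsto_of_le_of_le tendsto_const_nhds hlim (fun _ => zero_le)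
    fun n => ?_
  have hn : (1 : ℝ) ≤ (n : ℝ) + 1 := by linarith [n.cast_nonneg (α := ℝ)]
  have hn0 : (0 : ℝ) < (n : ℝ) + 1 := by linarith
  have hR : 1 ≤ Real.exp ((n : ℝ) + 1) := Real.one_le_exp hn0.le
  set A := Set.Icc 1 (Real.exp ((n : ℝ) + 1))
  -- As `k ≥ 2` and `n+1 ≥ 1`, only two of the `k` factors `1/(n+1)` are kept: one cancels `ln R =
  -- n+1`, the other tends to zero.
  set c : ℝ := C ^ k * D ^ (N - k) / ((n : ℝ) + 1) ^ 2 with hc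
  have hc0 : 0 ≤ c := by positivity
  have hpt : ∀ x : Rn N, ‖∇ (cutoff N n) x‖ₑ ^ k * ‖∇ (v N) x‖ₑ ^ (N - k) ≤
      ENNReal.ofReal c * ENNReal.ofReal (A.indicator (fun r => (r ^ N)⁻¹) ‖x‖) := by
    intro x
    rw [← ENNReal.ofReal_mul hc0, ← ofReal_norm, ← ofReal_norm,
      ← ENNReal.ofReal_pow (norm_nonneg _), ← ENNReal.ofReal_pow (norm_nonneg _),
      ← ENNReal.ofReal_mul (by positivity)]
    refine ENNReal.ofReal_le_ofReal ?_
    have h1 := hC n x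
    by_cases hx : ‖x‖ ∈ A
    · rw [Set.indicator_of_mem hx] at h1 ⊢
      have hx0 : 0 < ‖x‖ := zero_lt_one.trans_le hx.1
      have h2 : ‖∇ (v N) x‖ ≤ D * ‖x‖⁻¹ := by
        rw [← div_eq_mul_inv, le_div_iff₀ hx0]; exact (hD x).2
      calc _ ≤ (C / ((n : ℝ) + 1) * ‖x‖⁻¹) ^ k * (D * ‖x‖⁻¹) ^ (N - k) := by gcongr
        _ = (C ^ k * D ^ (N - k) / ((n : ℝ) + 1) ^ k) * (‖x‖⁻¹ ^ k * ‖x‖⁻¹ ^ (N - k)) := by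
          rw [mul_pow, mul_pow, div_pow]; ring
        _ = (C ^ k * D ^ (N - k) / ((n : ℝ) + 1) ^ k) * (‖x‖ ^ N)⁻¹ := by
          rw [← pow_add, Nat.add_sub_cancel' hkN, inv_pow]
        _ ≤ c * (‖x‖ ^ N)⁻¹ := by
          rw [hc]
          gcongr
    · rw [Set.indicator_of_notMem hx, mul_zero] at h1 ⊢
      have : ‖∇ (cutoff N n) x‖ = 0 := le_antisymm h1 (norm_nonneg _)
      rw [this, zero_pow (by omega), zero_mul]
  refine (lintegral_mono hpt).trans (le_of_eq ?_)
  rw [lintegral_const_mul' _ _ ENNReal.ofReal_ne_top, lintegral_annulus hN hR,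
    ← ENNReal.ofReal_mul hc0, Real.log_exp, hc]
  congr 1
  simp only [M]
  field_simp

end Cutoff

/-! ### The norm on pairs and the inclusion of the closure in `W`. -/

section PairNorm

variable {α F : Type*} [MeasurableSpace α] [NormedAddCommGroup F]

/-- Dominated convergence with majorant `(2|f|)^p`. The multipliers it serves are `1 - η_n`, `1 -
cos(u/c)` and `1 - sinc(u/c)`, all bounded by `2`. -/
theorem tendsto_eLpNorm_smul_zero [NormedSpace ℝ F] {m : Measure α} {p : ℝ≥0∞} (hp0 : p ≠ 0)
    (hp : p ≠ ⊤) {f : α → F} (hf : MemLp f p m) {c : ℕ → α → ℝ}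
    (hc : ∀ n, AEStronglyMeasurable (c n) m) (hb : ∀ n x, |c n x| ≤ 2)
    (hlim : ∀ᵐ x ∂m, Tendsto (fun n => c n x) atTop (𝓝 0)) :
    Tendsto (fun n => eLpNorm (fun x => c n x • f x) p m) atTop (𝓝 0) := by
  have hpr : 0 < p.toReal := ENNReal.toReal_pos hp0 hp
  have key : Tendsto (fun n => ∫⁻ x, ‖c n x • f x‖ₑ ^ p.toReal ∂m) atTop (𝓝 0) := by
    rw [← lintegral_zero (μ := m)]
    refine tendsto_lintegral_of_dominated_convergence'
      (fun x => (2 * ‖f x‖ₑ) ^ p.toReal) (fun n => ?_) (fun n => Eventually.of_forall fun x => ?_)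
      ?_ ?_
    · exact ((hc n).smul hf.aestronglyMeasurable).enorm.pow_const _
    · simp only [enorm_smul]
      gcongr
      rw [← ofReal_norm, Real.norm_eq_abs, ← ENNReal.ofReal_ofNat]
      exact ENNReal.ofReal_le_ofReal (hb n x)
    · simp_rw [ENNReal.mul_rpow_of_nonneg _ _ hpr.le]
      rw [lintegral_const_mul' _ _ (by finiteness)]
      exact ENNReal.mul_ne_top (by finiteness)
        (lintegral_rpow_enorm_lt_top_of_eLpNorm_lt_top hp0 hp hf.2).ne
    · filter_upwards [hlim] with x hx
      have := ((hx.smul_const (f x)).enorm).ennrpow_const p.toReal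
      simpa [ENNReal.zero_rpow_of_pos hpr] using this
  have := key.ennrpow_const (1 / p.toReal)
  rw [ENNReal.zero_rpow_of_pos (one_div_pos.2 hpr)] at this
  simpa only [eLpNorm_eq_lintegral_rpow_enorm_toReal hp0 hp] using this

theorem exists_limit_of_cauchy_eLpNorm [CompleteSpace F] {m : Measure α} {p : ℝ≥0∞} (hp1 : 1 ≤ p)
    {f : ℕ → α → F} (hf : ∀ n, MemLp (f n) p m)
    (hc : ∀ ε : ℝ≥0∞, 0 < ε → ∃ n₀, ∀ k ≥ n₀, ∀ n ≥ n₀, eLpNorm (f k - f n) p m < ε) :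
    ∃ u, StronglyMeasurable u ∧ MemLp u p m ∧
      Tendsto (fun n => eLpNorm (f n - u) p m) atTop (𝓝 0) := by
  have : Fact (1 ≤ p) := ⟨hp1⟩
  have hC : CauchySeq fun n => (hf n).toLp (f n) := by
    rw [EMetric.cauchySeq_iff]
    intro ε hε
    obtain ⟨n₀, h⟩ := hc ε hε
    exact ⟨n₀, fun k hk n hn => by rw [Lp.edist_toLp_toLp]; exact h k hk n hn⟩
  obtain ⟨u, hu⟩ := cauchySeq_tendsto_of_complete hC
  refine ⟨u, Lp.stronglyMeasurable u, Lp.memLp u, ?_⟩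
  refine ((Lp.tendsto_Lp_iff_tendsto_eLpNorm' _ _).1 hu).congr fun n => ?_
  exact eLpNorm_congr_ae ((hf n).coeFn_toLp.sub EventuallyEq.rfl)

theorem tendsto_eLpNorm_of_measure_le {m m' : Measure α} {p : ℝ≥0∞} (hp : p ≠ ⊤) {C : ℝ≥0∞}
    (hC : C ≠ ⊤) (hm : m' ≤ C • m) {f : ℕ → α → F}
    (h : Tendsto (fun n => eLpNorm (f n) p m) atTop (𝓝 0)) :
    Tendsto (fun n => eLpNorm (f n) p m') atTop (𝓝 0) := by
  have h1 : Tendsto (fun n => C ^ (1 / p).toReal * eLpNorm (f n) p m) atTop (𝓝 0) := by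
    simpa using ENNReal.Tendsto.const_mul h
      (Or.inr (ENNReal.rpow_ne_top_of_nonneg (ENNReal.toReal_nonneg (a := 1 / p)) hC))
  refine tendsto_of_tendsto_of_tendsto_of_le_of_le tendsto_const_nhds h1 (fun _ => zero_le)
    fun n => ?_
  refine (eLpNorm_mono_measure _ hm).trans ?_
  rw [eLpNorm_smul_measure_of_ne_top hp, smul_eq_mul]

theorem mu_absolutelyContinuous (N : ℕ) : mu N ≪ volume := withDensity_absolutelyContinuous _ _

theorem nu_absolutelyContinuous (N : ℕ) : nu N ≪ volume := withDensity_absolutelyContinuous _ _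

/-- The norm `‖·‖_{μ_N}` as a function of the pair (function, gradient). -/
noncomputable def pairNorm (u : Rn N → ℝ) (g : Rn N → Rn N) : ℝ≥0∞ :=
  eLpNorm u 1 (mu N) + eLpNorm g (N : ℝ≥0∞) volume + eLpNorm g 2 (nu N)

theorem lintegral_nu_sq {g : Rn N → Rn N} (hg : AEStronglyMeasurable g volume) :
    ∫⁻ x, ‖g x‖ₑ ^ 2 ∂(nu N) = ∫⁻ x, ‖g x‖ₑ ^ 2 * ‖∇ (v N) x‖ₑ ^ (N - 2) := by
  rw [nu, lintegral_withDensity_eq_lintegral_mul₀ (measurable_nu_density N).aemeasurable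
    (hg.enorm.pow_const 2)]
  exact lintegral_congr fun x => by rw [Pi.mul_apply, mul_comm]

theorem eLpNorm_two_eq {m : Measure α} (g : α → F) :
    eLpNorm g 2 m = (∫⁻ x, ‖g x‖ₑ ^ 2 ∂m) ^ (1 / 2 : ℝ) := by
  rw [eLpNorm_eq_lintegral_rpow_enorm_toReal (by simp) (by simp)]
  simp

/-- Weak gradients agree almost everywhere, also for `ν` since `ν ≪ dx`; hence any weak gradient may
stand for `weakGrad u`. -/
theorem HasWeakGradient.muNorm_eq {u : Rn N → ℝ} {g : Rn N → Rn N} (h : HasWeakGradient u g) :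
    muNorm N u = pairNorm u g := by
  have hw := WeaklyDifferentiable.hasWeakGradient ⟨g, h⟩
  have hae := hw.ae_unique h
  rw [muNorm, pairNorm, eLpNorm_one_eq_lintegral_enorm, eLpNorm_congr_ae hae,
    ← lintegral_nu_sq hw.locallyIntegrable_grad.aestronglyMeasurable, ← eLpNorm_two_eq,
    eLpNorm_congr_ae ((nu_absolutelyContinuous N).ae_eq hae)]

theorem pairNorm_add_le (hN : 2 ≤ N) {u u' : Rn N → ℝ} {g g' : Rn N → Rn N}
    (hu : AEStronglyMeasurable u volume) (hu' : AEStronglyMeasurable u' volume)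
    (hg : AEStronglyMeasurable g volume) (hg' : AEStronglyMeasurable g' volume) :
    pairNorm (u + u') (g + g') ≤ pairNorm u g + pairNorm u' g' := by
  have h1 := eLpNorm_add_le (hu.mono_ac (mu_absolutelyContinuous N))
    (hu'.mono_ac (mu_absolutelyContinuous N)) le_rfl
  have h2 := eLpNorm_add_le (p := (N : ℝ≥0∞)) hg hg' (by exact_mod_cast (by omega : 1 ≤ N))
  have h3 := eLpNorm_add_le (p := 2) (hg.mono_ac (nu_absolutelyContinuous N))
    (hg'.mono_ac (nu_absolutelyContinuous N)) one_le_two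
  calc _ ≤ _ := add_le_add (add_le_add h1 h2) h3
    _ = _ := by unfold pairNorm; abel

theorem tendsto_pairNorm {u : ℕ → Rn N → ℝ} {g : ℕ → Rn N → Rn N}
    (h1 : Tendsto (fun n => eLpNorm (u n) 1 (mu N)) atTop (𝓝 0))
    (h2 : Tendsto (fun n => eLpNorm (g n) (N : ℝ≥0∞) volume) atTop (𝓝 0))
    (h3 : Tendsto (fun n => eLpNorm (g n) 2 (nu N)) atTop (𝓝 0)) :
    Tendsto (fun n => pairNorm (u n) (g n)) atTop (𝓝 0) := by
  simpa [pairNorm] using (h1.add h2).add h3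

/-- Finiteness of the norm of a pair. -/
structure MemPair (u : Rn N → ℝ) (g : Rn N → Rn N) : Prop where
  memLp_mu : MemLp u 1 (mu N)
  memLp_grad : MemLp g (N : ℝ≥0∞) volume
  memLp_nu : MemLp g 2 (nu N)

theorem memPair_iff {u : Rn N → ℝ} {g : Rn N → Rn N} (hu : AEStronglyMeasurable u volume)
    (hg : AEStronglyMeasurable g volume) : MemPair u g ↔ pairNorm u g < ⊤ := by
  rw [pairNorm, ENNReal.add_lt_top, ENNReal.add_lt_top]
  exact ⟨fun h => ⟨⟨h.1.2, h.2.2⟩, h.3.2⟩, fun h =>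
    ⟨⟨hu.mono_ac (mu_absolutelyContinuous N), h.1.1⟩, ⟨hg, h.1.2⟩,
      ⟨hg.mono_ac (nu_absolutelyContinuous N), h.2⟩⟩⟩

theorem mem_W_iff {u : Rn N → ℝ} {g : Rn N → Rn N} (h : HasWeakGradient u g) :
    u ∈ W N ↔ MemPair u g := by
  have hd : WeaklyDifferentiable u := ⟨g, h⟩
  have hw := hd.hasWeakGradient
  have hae := hw.ae_unique h
  have hm := hw.locallyIntegrable_grad.aestronglyMeasurable
  have h3 : Integrable (fun x => ‖weakGrad u x‖ ^ 2 * ‖∇ (v N) x‖ ^ (N - 2)) volume ↔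
      MemLp (weakGrad u) 2 (nu N) := by
    have hm2 : AEStronglyMeasurable (fun x => ‖weakGrad u x‖ ^ 2 * ‖∇ (v N) x‖ ^ (N - 2))
        volume := (hm.norm.pow 2).mul
      ((measurable_gradient (v N)).norm.pow_const _).aestronglyMeasurable
    have e : ∫⁻ x, ‖‖weakGrad u x‖ ^ 2 * ‖∇ (v N) x‖ ^ (N - 2)‖ₑ =
        ∫⁻ x, ‖weakGrad u x‖ₑ ^ 2 ∂(nu N) := by
      rw [lintegral_nu_sq hm]
      exact lintegral_congr fun x => by simp [enorm_mul, enorm_pow]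
    have hiff : eLpNorm (weakGrad u) 2 (nu N) < ⊤ ↔
        ∫⁻ x, ‖weakGrad u x‖ₑ ^ 2 ∂(nu N) < ⊤ := by
      rw [eLpNorm_two_eq, ENNReal.rpow_lt_top_iff_of_pos (by norm_num)]
    unfold Integrable MemLp HasFiniteIntegral
    rw [e, hiff]
    exact ⟨fun h => ⟨hm.mono_ac (nu_absolutelyContinuous N), h.2⟩, fun h => ⟨hm2, h.2⟩⟩
  have hW : u ∈ W N ↔ WeaklyDifferentiable u ∧ Integrable u (mu N) ∧
    MemLp (weakGrad u) (N : ℝ≥0∞) volume ∧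
    Integrable (fun x => ‖weakGrad u x‖ ^ 2 * ‖∇ (v N) x‖ ^ (N - 2)) volume := Iff.rfl
  rw [hW, h3, memLp_congr_ae hae, memLp_congr_ae ((nu_absolutelyContinuous N).ae_eq hae),
    ← memLp_one_iff_integrable]
  exact ⟨fun h => ⟨h.2.1, h.2.2.1, h.2.2.2⟩, fun h => ⟨hd, h.1, h.2, h.3⟩⟩

theorem hasWeakGradient_of_mem_testFunctions {φ : Rn N → ℝ} (hφ : φ ∈ testFunctions N) :
    HasWeakGradient φ (∇ φ) :=
  hasWeakGradient_of_contDiff (hφ.1.of_le (by simp))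

theorem memPair_of_mem_testFunctions (hN : 2 ≤ N) {φ : Rn N → ℝ} (hφ : φ ∈ testFunctions N) :
    MemPair φ (∇ φ) := by
  obtain ⟨C, hC, hnu⟩ := exists_nu_le hN
  have hg := continuous_gradient (hφ.1.of_le (by simp) : ContDiff ℝ 1 φ)
  have hs := hasCompactSupport_gradient hφ.2
  exact ⟨(hφ.1.continuous.memLp_of_hasCompactSupport hφ.2).of_measure_le_smul
    ENNReal.ofReal_ne_top (mu_le N), hg.memLp_of_hasCompactSupport hs,
    (hg.memLp_of_hasCompactSupport hs).of_measure_le_smul hC hnu⟩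

/-- A single test function `φ` at distance less than `1` suffices: `u = (u - φ) + φ`, both of finite
norm. -/
theorem testClosure_subset_W (hN : 2 ≤ N) : testClosure N ⊆ W N := by
  rintro u ⟨⟨g, hg⟩, φ, hφ, hlim⟩
  have hlt : ∀ᶠ n in atTop, muNorm N (u - φ n) < 1 := hlim.eventually (gt_mem_nhds one_pos)
  obtain ⟨n, hn⟩ := hlt.exists
  have hφw := hasWeakGradient_of_mem_testFunctions (hφ n)
  have hd := hg.sub hφw
  rw [hd.muNorm_eq] at hn
  rw [mem_W_iff hg, memPair_iff hg.locallyIntegrable.aestronglyMeasurable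
    hg.locallyIntegrable_grad.aestronglyMeasurable]
  have hp := (memPair_iff hφw.locallyIntegrable.aestronglyMeasurable
    hφw.locallyIntegrable_grad.aestronglyMeasurable).1 (memPair_of_mem_testFunctions hN (hφ n))
  have := pairNorm_add_le hN hd.locallyIntegrable.aestronglyMeasurable
    hφw.locallyIntegrable.aestronglyMeasurable hd.locallyIntegrable_grad.aestronglyMeasurable
    hφw.locallyIntegrable_grad.aestronglyMeasurable
  rw [sub_add_cancel, sub_add_cancel] at this
  exact this.trans_lt (ENNReal.add_lt_top.2 ⟨hn.trans ENNReal.one_lt_top, hp⟩)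

end PairNorm

/-! ### Density of test functions. -/

section Density

/-- The pair `(u, g)` is a limit of pairs `(φ, ∇φ)` with `φ` a test function. -/
def Approximable (u : Rn N → ℝ) (g : Rn N → Rn N) : Prop :=
  ∀ ε : ℝ≥0∞, 0 < ε → ∃ φ ∈ testFunctions N, pairNorm (u - φ) (g - ∇ φ) < ε

/-- An `ε/2` argument that replaces diagonal sequences and lets the three reductions be chained. -/
theorem Approximable.of_tendsto (hN : 2 ≤ N) {u : Rn N → ℝ} {g : Rn N → Rn N}
    {un : ℕ → Rn N → ℝ} {gn : ℕ → Rn N → Rn N} (h : HasWeakGradient u g)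
    (hn : ∀ n, HasWeakGradient (un n) (gn n)) (ha : ∀ n, Approximable (un n) (gn n))
    (hlim : Tendsto (fun n => pairNorm (u - un n) (g - gn n)) atTop (𝓝 0)) :
    Approximable u g := by
  intro ε hε
  have hε2 : 0 < ε / 2 := ENNReal.half_pos hε.ne'
  obtain ⟨n, hlt⟩ := (hlim.eventually (gt_mem_nhds hε2)).exists
  obtain ⟨φ, hφ, hφlt⟩ := ha n (ε / 2) hε2
  refine ⟨φ, hφ, ?_⟩
  have h1 := h.sub (hn n)
  have h2 := (hn n).sub (hasWeakGradient_of_mem_testFunctions hφ)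
  have := pairNorm_add_le hN h1.locallyIntegrable.aestronglyMeasurable
    h2.locallyIntegrable.aestronglyMeasurable h1.locallyIntegrable_grad.aestronglyMeasurable
    h2.locallyIntegrable_grad.aestronglyMeasurable
  rw [sub_add_sub_cancel, sub_add_sub_cancel] at this
  calc _ ≤ _ := this
    _ < ε / 2 + ε / 2 := ENNReal.add_lt_add hlt hφlt
    _ = ε := ENNReal.add_halves ε

/-- Compactly supported functions are approximated by their mollifications. -/
theorem approximable_of_hasCompactSupport (hN : 2 ≤ N) {u : Rn N → ℝ} {g : Rn N → Rn N}
    (h : HasWeakGradient u g) (hu : HasCompactSupport u) (hgs : HasCompactSupport g)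
    (hg : MemLp g (N : ℝ≥0∞) volume) : Approximable u g := by
  obtain ⟨C, hC, hnu⟩ := exists_nu_le hN
  have hφ : ∀ n, mollify n u ∈ testFunctions N := fun n =>
    ⟨contDiff_mollify n h.locallyIntegrable, hasCompactSupport_mollify n hu⟩
  have hu1 : MemLp u 1 volume := by
    rw [memLp_one_iff_integrable]
    refine (integrableOn_iff_integrable_of_support_subset (subset_tsupport u)).1 ?_
    exact h.locallyIntegrable.integrableOn_isCompact hu
  -- Hölder's inequality on the support of `g`, which has finite measure; this uses `2 ≤ N`.
  have hg2 : MemLp g 2 volume :=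
    hg.mono_exponent_of_measure_support_ne_top
      (fun x hx => image_eq_zero_of_notMem_tsupport hx) hgs.measure_lt_top.ne
      (by exact_mod_cast hN)
  have hlim : Tendsto (fun n => pairNorm (mollify n u - u) (mollify n g - g)) atTop (𝓝 0) :=
    tendsto_pairNorm
      (tendsto_eLpNorm_of_measure_le ENNReal.one_ne_top ENNReal.ofReal_ne_top (mu_le N)
        (tendsto_eLpNorm_mollify_sub le_rfl ENNReal.one_ne_top hu1))
      (tendsto_eLpNorm_mollify_sub (by exact_mod_cast (by omega : 1 ≤ N))
        (ENNReal.natCast_ne_top N) hg)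
      (tendsto_eLpNorm_of_measure_le ENNReal.ofNat_ne_top hC hnu
        (tendsto_eLpNorm_mollify_sub one_le_two ENNReal.ofNat_ne_top hg2))
  intro ε hε
  obtain ⟨n, hn⟩ := (hlim.eventually (gt_mem_nhds hε)).exists
  refine ⟨mollify n u, hφ n, ?_⟩
  rw [h.gradient_mollify n]
  rwa [pairNorm, eLpNorm_sub_comm, eLpNorm_sub_comm g, eLpNorm_sub_comm g]

theorem tendsto_eLpNorm_gradient_cutoff (hN : 2 ≤ N) :
    Tendsto (fun n => eLpNorm (∇ (cutoff N n)) (N : ℝ≥0∞) volume) atTop (𝓝 0) ∧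
      Tendsto (fun n => eLpNorm (∇ (cutoff N n)) 2 (nu N)) atTop (𝓝 0) := by
  have hN0 : (N : ℝ≥0∞) ≠ 0 := by exact_mod_cast (by omega : N ≠ 0)
  have hNr : (0 : ℝ) < N := by exact_mod_cast (by omega : 0 < N)
  constructor
  · have := (tendsto_lintegral_gradient_cutoff hN hN le_rfl).ennrpow_const (1 / (N : ℝ))
    rw [ENNReal.zero_rpow_of_pos (one_div_pos.2 hNr)] at this
    refine this.congr fun n => ?_
    rw [eLpNorm_eq_lintegral_rpow_enorm_toReal hN0 (ENNReal.natCast_ne_top N)]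
    simp
  · have := (tendsto_lintegral_gradient_cutoff hN le_rfl hN).ennrpow_const (1 / 2 : ℝ)
    rw [ENNReal.zero_rpow_of_pos (by norm_num)] at this
    refine this.congr fun n => ?_
    rw [eLpNorm_two_eq, lintegral_nu_sq]
    exact (measurable_gradient _).aestronglyMeasurable

/-- Bounded functions of finite norm are approximable. -/
theorem approximable_of_bounded (hN : 2 ≤ N) {u : Rn N → ℝ} {g : Rn N → Rn N}
    (h : HasWeakGradient u g) (hm : MemPair u g) {B : ℝ} (hB : ∀ x, |u x| ≤ B) :
    Approximable u g := by
  obtain ⟨hcN, hc2⟩ := tendsto_eLpNorm_gradient_cutoff hN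
  have hN1 : (1 : ℝ≥0∞) ≤ N := by exact_mod_cast (by omega : 1 ≤ N)
  have hum := h.locallyIntegrable.aestronglyMeasurable
  have hgm := h.locallyIntegrable_grad.aestronglyMeasurable
  have hcont : ∀ n, Continuous (fun x : Rn N => 1 - cutoff N n x) := fun n =>
    continuous_const.sub (contDiff_cutoff N n).continuous
  have hb : ∀ (n : ℕ) (x : Rn N), |1 - cutoff N n x| ≤ 2 := fun n x => by
    rw [abs_le]
    constructor <;> linarith [cutoff_nonneg n x, cutoff_le_one n x]
  have hlim : ∀ x : Rn N, Tendsto (fun n => 1 - cutoff N n x) atTop (𝓝 0) := fun x => by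
    simpa using (tendsto_cutoff x).const_sub 1
  have hgc : ∀ n, Continuous (∇ (cutoff N n)) := fun n =>
    continuous_gradient ((contDiff_cutoff N n).of_le (by simp))
  have hgcs : ∀ n, HasCompactSupport (∇ (cutoff N n)) := fun n =>
    hasCompactSupport_gradient (hasCompactSupport_cutoff N n)
  have hdom : ∀ n, MemLp (fun x => u x • ∇ (cutoff N n) x) (N : ℝ≥0∞) volume := fun n =>
    ((hgc n).memLp_of_hasCompactSupport (hgcs n)).of_le_mul (c := B)
      (hum.smul (hgc n).aestronglyMeasurable) (Eventually.of_forall fun x => by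
        rw [norm_smul]
        exact mul_le_mul_of_nonneg_right (hB x) (norm_nonneg _))
  -- One statement for both gradient seminorms: the error is `(1 - η_n) g - u ∇η_n`, where dominated
  -- convergence handles the first term and the bound `B ‖∇η_n‖` the second.
  have hgrad : ∀ (p : ℝ≥0∞) (m : Measure (Rn N)), 1 ≤ p → p ≠ ⊤ → m ≪ volume → MemLp g p m →
      Tendsto (fun n => eLpNorm (∇ (cutoff N n)) p m) atTop (𝓝 0) →
      Tendsto (fun n => eLpNorm (g - fun x => cutoff N n x • g x + u x • ∇ (cutoff N n) x) p m)
        atTop (𝓝 0) := by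
    intro p m hp1 hp hac hgp hcp
    have t1 := tendsto_eLpNorm_smul_zero (zero_lt_one.trans_le hp1).ne' hp hgp
      (fun n => (hcont n).aestronglyMeasurable) hb (Eventually.of_forall hlim)
    have t2 : Tendsto (fun n => ENNReal.ofReal B * eLpNorm (∇ (cutoff N n)) p m) atTop
        (𝓝 0) := by
      simpa using ENNReal.Tendsto.const_mul hcp (Or.inr ENNReal.ofReal_ne_top)
    have t3 := t1.add t2
    rw [add_zero] at t3
    refine tendsto_of_tendsto_of_tendsto_of_le_of_le tendsto_const_nhds t3 (fun _ => zero_le)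
      fun n => ?_
    have e : (g - fun x => cutoff N n x • g x + u x • ∇ (cutoff N n) x) =
        (fun x => (1 - cutoff N n x) • g x) - fun x => u x • ∇ (cutoff N n) x := by
      funext x
      simp only [Pi.sub_apply]
      module
    dsimp only
    rw [e]
    refine (eLpNorm_sub_le ((hcont n).aestronglyMeasurable.smul hgp.aestronglyMeasurable)
      ((hum.mono_ac hac).smul (hgc n).aestronglyMeasurable) hp1).trans (add_le_add le_rfl ?_)
    exact eLpNorm_le_mul_eLpNorm_of_ae_le_mul (Eventually.of_forall fun x => by
      rw [Pi.smul_apply', norm_smul]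
      exact mul_le_mul_of_nonneg_right (hB x) (norm_nonneg _)) p
  refine Approximable.of_tendsto hN h (un := fun n x => cutoff N n x * u x)
    (gn := fun n x => cutoff N n x • g x + u x • ∇ (cutoff N n) x)
    (fun n => h.mul_smooth (contDiff_cutoff N n)) (fun n => ?_) (tendsto_pairNorm ?_ ?_ ?_)
  · refine approximable_of_hasCompactSupport hN (h.mul_smooth (contDiff_cutoff N n))
      (hasCompactSupport_cutoff N n).mul_right ?_ ?_
    · exact (HasCompactSupport.smul_right (f := cutoff N n) (f' := g)
        (hasCompactSupport_cutoff N n)).add (HasCompactSupport.smul_left (f := u) (hgcs n))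
    · refine MemLp.add (hm.memLp_grad.of_le ((contDiff_cutoff N
        n).continuous.aestronglyMeasurable.smul hgm) (Eventually.of_forall fun x => ?_)) (hdom n)
      rw [norm_smul, Real.norm_of_nonneg (cutoff_nonneg n x)]
      exact mul_le_of_le_one_left (norm_nonneg _) (cutoff_le_one n x)
  · refine (tendsto_eLpNorm_smul_zero one_ne_zero ENNReal.one_ne_top hm.memLp_mu
      (fun n => (hcont n).aestronglyMeasurable) hb (Eventually.of_forall hlim)).congr fun n => ?_
    congr 1
    funext x
    simp only [Pi.sub_apply, smul_eq_mul]
    ring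
  · exact hgrad _ _ hN1 (ENNReal.natCast_ne_top N) Measure.AbsolutelyContinuous.rfl
      hm.memLp_grad hcN
  · exact hgrad _ _ one_le_two ENNReal.ofNat_ne_top (nu_absolutelyContinuous N) hm.memLp_nu hc2

/-- Makes the truncation `c sin(u/c)` a multiple of `u` by a factor bounded by `1` and tending to
`1` as `c → ∞`, so finiteness and convergence are immediate. -/
theorem mul_sin_div_eq {c : ℝ} (hc : c ≠ 0) (t : ℝ) :
    c * Real.sin (t / c) = Real.sinc (t / c) * t := by
  rcases eq_or_ne t 0 with rfl | ht
  · simp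
  · rw [Real.sinc_of_ne_zero (div_ne_zero ht hc)]
    field_simp

theorem tendsto_div_natCast_add_one (t : ℝ) :
    Tendsto (fun n : ℕ => t / ((n : ℝ) + 1)) atTop (𝓝 0) := by
  simpa [div_eq_mul_inv] using (tendsto_one_div_add_atTop_nhds_zero_nat (𝕜 := ℝ)).const_mul t

/-- Every pair of finite norm is approximable, by the bounded truncations `c sin(u/c)`. -/
theorem approximable (hN : 2 ≤ N) {u : Rn N → ℝ} {g : Rn N → Rn N}
    (h : HasWeakGradient u g) (hm : MemPair u g) : Approximable u g := by
  have hum := h.locallyIntegrable.aestronglyMeasurable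
  have hc : ∀ n : ℕ, (0 : ℝ) < (n : ℝ) + 1 := fun n => by positivity
  -- The scale is `c = n+1`. The derivative of `c sin(t/c)` is `cos(t/c)`, continuous and bounded by
  -- one, so the `C^1` chain rule applies.
  have hd : ∀ n : ℕ, HasWeakGradient (fun x => ((n : ℝ) + 1) * Real.sin (u x / ((n : ℝ) + 1)))
      (fun x => Real.cos (u x / ((n : ℝ) + 1)) • g x) := fun n => by
    refine h.comp (f := fun t => ((n : ℝ) + 1) * Real.sin (t / ((n : ℝ) + 1)))
      (f' := fun t => Real.cos (t / ((n : ℝ) + 1))) (fun t => ?_) (by fun_prop)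
      fun t => Real.abs_cos_le_one _
    have := (((hasDerivAt_id t).div_const ((n : ℝ) + 1)).sin).const_mul ((n : ℝ) + 1)
    refine this.congr_deriv ?_
    have := (hc n).ne'
    simp only [id]
    field_simp
  have hcos : ∀ (p : ℝ≥0∞) (m : Measure (Rn N)), p ≠ 0 → p ≠ ⊤ → m ≪ volume → MemLp g p m →
      Tendsto (fun n : ℕ => eLpNorm (g - fun x => Real.cos (u x / ((n : ℝ) + 1)) • g x) p m)
        atTop (𝓝 0) := by
    intro p m hp0 hp hac hgp
    refine (tendsto_eLpNorm_smul_zero hp0 hp hgp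
      (c := fun (n : ℕ) x => 1 - Real.cos (u x / ((n : ℝ) + 1))) (fun n => ?_) (fun n x => ?_)
      (Eventually.of_forall fun x => ?_)).congr fun n => ?_
    · exact (by fun_prop : Continuous fun t : ℝ =>
        1 - Real.cos (t / ((n : ℝ) + 1))).comp_aestronglyMeasurable (hum.mono_ac hac)
    · rw [abs_le]
      constructor <;> linarith [Real.cos_le_one (u x / ((n : ℝ) + 1)),
        Real.neg_one_le_cos (u x / ((n : ℝ) + 1))]
    · have := ((Real.continuous_cos.tendsto 0).comp
        (tendsto_div_natCast_add_one (u x))).const_sub 1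
      simpa using this
    · congr 1
      funext x
      simp only [Pi.sub_apply, sub_smul, one_smul]
  have hbd : ∀ (n : ℕ) (x : Rn N), |((n : ℝ) + 1) * Real.sin (u x / ((n : ℝ) + 1))| ≤
      (n : ℝ) + 1 := fun n x => by
    rw [abs_mul, abs_of_pos (hc n)]
    exact mul_le_of_le_one_right (hc n).le (Real.abs_sin_le_one _)
  have hcosle : ∀ (n : ℕ) (x : Rn N), ‖Real.cos (u x / ((n : ℝ) + 1)) • g x‖ ≤ ‖g x‖ :=
    fun n x => by
      rw [norm_smul]
      exact mul_le_of_le_one_left (norm_nonneg _) (Real.abs_cos_le_one _)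
  refine Approximable.of_tendsto hN h hd (fun n => approximable_of_bounded hN (hd n) ?_ (hbd n))
    (tendsto_pairNorm ?_ ?_ ?_)
  · have hm1 := (hd n).locallyIntegrable.aestronglyMeasurable
    have hm2 := (hd n).locallyIntegrable_grad.aestronglyMeasurable
    refine ⟨hm.memLp_mu.of_le (hm1.mono_ac (mu_absolutelyContinuous N))
      (Eventually.of_forall fun x => ?_), hm.memLp_grad.of_le hm2 (Eventually.of_forall (hcosle n)),
      hm.memLp_nu.of_le (hm2.mono_ac (nu_absolutelyContinuous N))
      (Eventually.of_forall (hcosle n))⟩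
    rw [mul_sin_div_eq (hc n).ne', norm_mul]
    exact mul_le_of_le_one_left (norm_nonneg _) (Real.abs_sinc_le_one _)
  · refine (tendsto_eLpNorm_smul_zero one_ne_zero ENNReal.one_ne_top hm.memLp_mu
      (c := fun (n : ℕ) x => 1 - Real.sinc (u x / ((n : ℝ) + 1))) (fun n => ?_) (fun n x => ?_)
      (Eventually.of_forall fun x => ?_)).congr fun n => ?_
    · have : Continuous fun t : ℝ => 1 - Real.sinc (t / ((n : ℝ) + 1)) :=
        continuous_const.sub (Real.continuous_sinc.comp (continuous_id.div_const _))
      exact this.comp_aestronglyMeasurable (hum.mono_ac (mu_absolutelyContinuous N))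
    · rw [abs_le]
      constructor <;> linarith [Real.sinc_le_one (u x / ((n : ℝ) + 1)),
        Real.neg_one_le_sinc (u x / ((n : ℝ) + 1))]
    · have := ((Real.continuous_sinc.tendsto 0).comp
        (tendsto_div_natCast_add_one (u x))).const_sub 1
      simpa using this
    · congr 1
      funext x
      simp only [Pi.sub_apply, mul_sin_div_eq (hc n).ne', smul_eq_mul]
      ring
  · exact hcos _ _ (by exact_mod_cast (by omega : N ≠ 0)) (ENNReal.natCast_ne_top N)
      Measure.AbsolutelyContinuous.rfl hm.memLp_grad
  · exact hcos _ _ two_ne_zero ENNReal.ofNat_ne_top (nu_absolutelyContinuous N) hm.memLp_nu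

theorem W_subset_testClosure (hN : 2 ≤ N) : W N ⊆ testClosure N := by
  intro u hu
  have hw := hu.1.hasWeakGradient
  have ha := approximable hN hw ((mem_W_iff hw).1 hu)
  choose φ hφ hlt using fun n : ℕ => ha ((n : ℝ≥0∞) + 1)⁻¹ (by simp)
  refine ⟨hu.1, φ, hφ, ?_⟩
  have h0 : Tendsto (fun n : ℕ => ((n : ℝ≥0∞) + 1)⁻¹) atTop (𝓝 0) := by
    have := (tendsto_add_atTop_iff_nat 1).2 ENNReal.tendsto_inv_nat_nhds_zero
    exact_mod_cast this
  refine tendsto_of_tendsto_of_tendsto_of_le_of_le tendsto_const_nhds h0 (fun _ => zero_le)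
    fun n => ?_
  dsimp only
  rw [(hw.sub (hasWeakGradient_of_mem_testFunctions (hφ n))).muNorm_eq]
  exact (hlt n).le

end Density

/-! ### Limits of Cauchy sequences of test functions. -/

section Completeness

theorem exists_tendsto_of_isMuCauchy (hN : 2 ≤ N) {φ : ℕ → Rn N → ℝ}
    (hφ : ∀ n, φ n ∈ testFunctions N) (hc : IsMuCauchy N φ) :
    ∃ u g, HasWeakGradient u g ∧ Tendsto (fun n => muNorm N (u - φ n)) atTop (𝓝 0) := by
  have hN1 : (1 : ℝ≥0∞) ≤ N := by exact_mod_cast (by omega : 1 ≤ N)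
  have hw := fun n => hasWeakGradient_of_mem_testFunctions (hφ n)
  have hmem := fun n => memPair_of_mem_testFunctions hN (hφ n)
  have hgm : ∀ n, AEStronglyMeasurable (∇ (φ n)) volume := fun n =>
    (measurable_gradient _).aestronglyMeasurable
  have hc' : ∀ ε : ℝ≥0∞, 0 < ε → ∃ n₀, ∀ m ≥ n₀, ∀ n ≥ n₀,
      pairNorm (φ m - φ n) (∇ (φ m) - ∇ (φ n)) < ε := by
    intro ε hε
    obtain ⟨n₀, h⟩ := hc ε hε
    exact ⟨n₀, fun m hm n hn => by rw [← ((hw m).sub (hw n)).muNorm_eq]; exact h m hm n hn⟩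
  obtain ⟨u, hus, huL, hulim⟩ := exists_limit_of_cauchy_eLpNorm le_rfl
    (fun n => (hmem n).memLp_mu) fun ε hε => (hc' ε hε).imp fun n₀ h m hm n hn =>
      lt_of_le_of_lt (by unfold pairNorm; rw [add_assoc]; exact le_self_add) (h m hm n hn)
  obtain ⟨g, hgs, hgL, hglim⟩ := exists_limit_of_cauchy_eLpNorm hN1
    (fun n => (hmem n).memLp_grad) fun ε hε => (hc' ε hε).imp fun n₀ h m hm n hn =>
      lt_of_le_of_lt (by unfold pairNorm; rw [add_assoc]; exact le_add_left le_self_add)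
        (h m hm n hn)
  have huloc : LocallyIntegrable u volume := locallyIntegrable_iff.2 fun K hK => by
    obtain ⟨C, hC, hle⟩ := exists_restrict_volume_le_mu hN hK
    exact memLp_one_iff_integrable.1 (huL.of_measure_le_smul hC hle)
  have hgrad : HasWeakGradient u g := by
    refine HasWeakGradient.of_tendsto hw huloc (hgL.locallyIntegrable hN1) (fun K hK => ?_)
      (fun K hK => ?_)
    · obtain ⟨C, hC, hle⟩ := exists_restrict_volume_le_mu hN hK
      exact tendsto_eLpNorm_of_measure_le ENNReal.one_ne_top hC hle hulim
    -- `b = |K|^{1 - 1/N}` is the Hölder constant from `L^N(K)` to `L^1(K)`.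
    · set b : ℝ≥0∞ := (volume.restrict K : Measure (Rn N)) Set.univ ^
        (1 / (1 : ℝ≥0∞).toReal - 1 / (N : ℝ≥0∞).toReal) with hb
      have hbt : b ≠ ⊤ := by
        refine ENNReal.rpow_ne_top_of_nonneg ?_ ?_
        · have : (1 : ℝ) ≤ N := by exact_mod_cast (by omega : 1 ≤ N)
          simpa using inv_le_one_of_one_le₀ this
        · rw [Measure.restrict_apply_univ]; exact hK.measure_lt_top.ne
      have h1 : Tendsto (fun n => eLpNorm (∇ (φ n) - g) (N : ℝ≥0∞) volume * b) atTop (𝓝 0) := by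
        simpa using ENNReal.Tendsto.mul_const hglim (Or.inr hbt)
      refine tendsto_of_tendsto_of_tendsto_of_le_of_le tendsto_const_nhds h1 (fun _ => zero_le)
        fun n => ?_
      refine (eLpNorm_le_eLpNorm_mul_rpow_measure_univ hN1
        ((hgm n).sub hgs.aestronglyMeasurable).restrict).trans ?_
      gcongr
      exact Measure.restrict_le_self
  -- No limit in `L²(ν)` needs to be identified with `g`: a subsequence of `∇φ_k` converges to `g`
  -- almost everywhere, and Fatou's lemma bounds `‖g - ∇φ_n‖` by the lower limit of the Cauchy
  -- differences.
  have hnulim : Tendsto (fun n => eLpNorm (g - ∇ (φ n)) 2 (nu N)) atTop (𝓝 0) := by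
    obtain ⟨ns, hns, hae⟩ := (tendstoInMeasure_of_tendsto_eLpNorm
      (zero_lt_one.trans_le hN1).ne' hgm hgs.aestronglyMeasurable hglim).exists_seq_tendsto_ae
    rw [ENNReal.tendsto_nhds_zero]
    intro ε hε
    obtain ⟨n₀, h⟩ := hc' ε hε
    filter_upwards [eventually_ge_atTop n₀] with n hn
    refine (Lp.eLpNorm_lim_le_liminf_eLpNorm (f := fun k => ∇ (φ (ns k)) - ∇ (φ n))
      (fun k => ((measurable_gradient _).sub (measurable_gradient _)).aestronglyMeasurable) _
      ?_).trans ?_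
    · filter_upwards [(nu_absolutelyContinuous N).ae_le hae] with x hx
      exact hx.sub_const _
    · refine liminf_le_of_frequently_le' (Eventually.frequently ?_)
      filter_upwards [eventually_ge_atTop n₀] with k hk
      refine le_trans ?_ (h (ns k) (hk.trans (hns.id_le k)) n hn).le
      unfold pairNorm
      exact le_add_self
  refine ⟨u, g, hgrad, ?_⟩
  have e : ∀ n, muNorm N (u - φ n) = pairNorm (u - φ n) (g - ∇ (φ n)) := fun n =>
    (hgrad.sub (hw n)).muNorm_eq
  simp_rw [e]
  refine tendsto_pairNorm (hulim.congr fun n => eLpNorm_sub_comm _ _ _ _)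
    (hglim.congr fun n => eLpNorm_sub_comm _ _ _ _) hnulim

end Completeness

end Onofri

theorem theorem1p1 (N : ℕ) (hN : 2 ≤ N) :
    Onofri.W N = Onofri.testClosure N ∧
    (∀ φ : ℕ → Onofri.Rn N → ℝ, (∀ n, φ n ∈ Onofri.testFunctions N) →
      Onofri.IsMuCauchy N φ →
      ∃ u ∈ Onofri.W N, Tendsto (fun n => Onofri.muNorm N (u - φ n)) atTop (𝓝 0)) := by
  refine ⟨Set.Subset.antisymm (Onofri.W_subset_testClosure hN) (Onofri.testClosure_subset_W hN),
    fun φ hφ hc => ?_⟩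
  obtain ⟨u, g, hg, hlim⟩ := Onofri.exists_tendsto_of_isMuCauchy hN hφ hc
  -- The limit lies in the closure by construction, so membership in `W` comes from the easy
  -- inclusion.
  exact ⟨u, Onofri.testClosure_subset_W hN ⟨⟨g, hg⟩, φ, hφ, hlim⟩, hlim⟩
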